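/- Let $\gamma$ be the Euler–Mascheroni constant, $\zeta$ the Riemann zeta function and $\log$ the natural logarithm. Let $\omega(s)$ be the zeta function of $SU(3)$, that is, the (unique) meromorphic continuation to $\mathbb{C}$ of the Dirichlet series $\sum_{j,k=1}^{\infty}\bigl(jk(j+k)\bigr)^{-s}$, which converges absolutely for $\operatorname{Re}(s)>2/3$. Then $\omega$ is holomorphic at $s=0$, the integral below converges absolutely, and $$\omega'(0)=\frac{1}{12}(1+\gamma)+\frac34\log(2\pi)-2\zeta'(-1)+\frac12\int_{-\infty}^{\infty}\frac{\zeta\left(\frac32+it\right)\zeta\left(-\frac32-it\right)}{\left(\frac32+it\right)\cosh(\pi t)}\,dt=1.83787706640934548356\ldots,$$ where the decimal expansion is truncated, i.e. $1.83787706640934548356\le\omega'(0)<1.83787706640934548357$. -/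

import Mathlib

/-- `ω` is the meromorphic continuation to `ℂ` of the Dirichlet series
`∑_{j,k ≥ 1} (j k (j + k)) ^ (-s)`: it is meromorphic on `ℂ` and is the sum of the series wherever
`Re s > 2/3`. A meromorphic function is a total function here; the normal form condition says that
it has its regular value at each point where the singularity is removable
(and the conventional value `0` at each pole). -/
structure IsSU3Zeta (ω : ℂ → ℂ) : Prop where
  meromorphic : MeromorphicNFOn ω Set.univ
  hasSum : ∀ s : ℂ, 2 / 3 < s.re →
    HasSum (fun p : ℕ+ × ℕ+ => 1 / ((p.1 : ℂ) * (p.2 : ℂ) * ((p.1 : ℂ) + (p.2 : ℂ))) ^ s) (ω s)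

/-- The function `t ↦ ζ(3/2 + i t) ζ(-3/2 - i t) / ((3/2 + i t) cosh (π t))`. -/
noncomputable def su3Integrand (t : ℝ) : ℂ :=
  riemannZeta (3 / 2 + Complex.I * t) * riemannZeta (-3 / 2 - Complex.I * t) /
    ((3 / 2 + Complex.I * t) * (Real.cosh (Real.pi * t) : ℂ))

/-! Both sides of the formula equal $\log(2\pi)$; this is proved separately for the derivative and
for the right-hand side. The common tool is $\mathrm{Li}_s(e^{-t})$ (`polylogExp s t`), which for
$\operatorname{Re}s<1$ behaves near $t=0^+$ like $\Gamma(1-s)t^{s-1}+\sum_k(-1)^k\zeta(s-k)t^k/k!$,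
with remainders bounded locally uniformly in $s$ (`exists_norm_polylogRem_le`).

Derivative. For $\operatorname{Re}s>2/3$, $\Gamma(s)\omega(s)$ is the Mellin transform at $s$ of
$\mathrm{Li}_s(e^{-t})^2$. Splitting at $t=1$ and subtracting the squared truncated expansion on
$(0,1]$ continues it meromorphically (`mellin_polylogExp_sq`). The regular integrals cannot be
evaluated, but at $s=0$ they coincide with those for $\mathrm{Li}_0(e^{-t})^2$, whose Mellin
transform is $\Gamma(s)(\zeta(s-1)-\zeta(s))$. Their difference vanishes at $0$, and so does
$1/\Gamma(s)$, so only explicit singular terms contribute to $\omega'(0)$. The terms in $\Gamma'(1)$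
and $\zeta'(-1)$ cancel, leaving $2\zeta(0)\zeta'(0)-\zeta'(0)=-2\zeta'(0)=\log(2\pi)$
(`IsSU3Zeta.hasDerivAt_zero`).

Integral. Put $R(x)=1/(e^x-1)-1/x+1/2-x/12$. Its Mellin transform is $\Gamma\zeta$ on
$-2<\operatorname{Re}s<-1$, while that of $\mathrm{Li}_0(e^{-x})=1/(e^x-1)$ is $\Gamma\zeta$ on
$\operatorname{Re}s>1$. As $\Gamma(z)\Gamma(-z)=\pi/(z\cosh\pi t)$ for $z=3/2+it$, Parseval turns
half the integral into $\int_0^\infty \mathrm{Li}_0(e^{-x})R(x)\,dx/x$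
(`half_integral_su3Integrand`). The Mellin transform of that product is explicit for
$\operatorname{Re}s>2$; continuing it to $s=0$ gives
$2\zeta'(-1)+\frac14\log(2\pi)-\frac1{12}(1+\gamma)$ (`mellin_polylogExp_mul_rem_zero`), exactly
what is missing from $\log(2\pi)$. -/

open Filter Topology MeasureTheory Set Asymptotics

/-! ### Identity theorem and holomorphic parameter integrals. -/

/-- Identity theorem for meromorphic functions on a preconnected set. -/
theorem MeromorphicOn.eventuallyEq_nhdsNE_of_isPreconnected {f g : ℂ → ℂ} {U : Set ℂ}
    (hf : MeromorphicOn f U) (hg : MeromorphicOn g U) (hU : IsPreconnected U) {x y : ℂ}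
    (hx : x ∈ U) (hy : y ∈ U) (h : f =ᶠ[𝓝[≠] x] g) : f =ᶠ[𝓝[≠] y] g := by
  have h1 : meromorphicOrderAt (f - g) x = ⊤ := by
    rw [meromorphicOrderAt_eq_top_iff]
    filter_upwards [h] with z hz
    simp [hz]
  have h2 : meromorphicOrderAt (f - g) y = ⊤ := by
    by_contra h3
    exact (hf.sub hg).meromorphicOrderAt_ne_top_of_isPreconnected hU hy hx h3 h1
  rw [meromorphicOrderAt_eq_top_iff] at h2
  filter_upwards [h2] with z hz
  simpa [sub_eq_zero] using hz

/-- A parameter integral of holomorphic functions that are locally uniformly dominated is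
holomorphic. -/
theorem differentiableOn_integral_of_locally_dominated {α : Type*} [MeasurableSpace α]
    {μ : Measure α} {U : Set ℂ} (hU : IsOpen U) {f : ℂ → α → ℂ}
    (hmeas : ∀ s ∈ U, AEStronglyMeasurable (f s) μ)
    (hdiff : ∀ᵐ x ∂μ, DifferentiableOn ℂ (fun s => f s x) U)
    (hb : ∀ s ∈ U, ∃ V ∈ 𝓝 s, ∃ b : α → ℝ, Integrable b μ ∧ ∀ᵐ x ∂μ, ∀ z ∈ V, ‖f z x‖ ≤ b x) :
    DifferentiableOn ℂ (fun s => ∫ x, f s x ∂μ) U := by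
  intro s hs
  obtain ⟨V, hV, b, hbi, hb⟩ := hb s hs
  obtain ⟨r, hr, hrV⟩ := Metric.mem_nhds_iff.1 (inter_mem hV (hU.mem_nhds hs))
  have hbound : ∀ᵐ x ∂μ, ∀ z ∈ Metric.ball s (r / 2),
      ‖deriv (fun s => f s x) z‖ ≤ b x / (r / 4) := by
    filter_upwards [hdiff, hb] with x hx hbx z hz
    -- Discs of radius `r / 4` about points of the ball of radius `r / 2` stay in the ball of radius
    -- `r`, so Cauchy's estimate turns the bound on `f` into one on its derivative.
    have hsub : Metric.closedBall z (r / 4) ⊆ V ∩ U := by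
      intro y hy
      apply hrV
      rw [Metric.mem_ball] at hz ⊢
      rw [Metric.mem_closedBall] at hy
      linarith [dist_triangle y z s]
    refine Complex.norm_deriv_le_of_forall_mem_sphere_norm_le (by positivity) ?_ ?_
    · refine DifferentiableOn.diffContOnCl ?_
      rw [closure_ball _ (by positivity)]
      exact hx.mono (hsub.trans inter_subset_right)
    · exact fun y hy => hbx y (hsub (Metric.sphere_subset_closedBall hy)).1
  have hder : ∀ᵐ x ∂μ, ∀ z ∈ Metric.ball s (r / 2),
      HasDerivAt (fun s => f s x) (deriv (fun s => f s x) z) z := by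
    filter_upwards [hdiff] with x hx z hz
    refine (hx.differentiableAt (hU.mem_nhds ?_)).hasDerivAt
    exact (hrV (Metric.ball_subset_ball (by linarith) hz)).2
  have hsb : s ∈ Metric.ball s (r / 2) := Metric.mem_ball_self (by positivity)
  have hmeas' : AEStronglyMeasurable (fun x => deriv (fun s => f s x) s) μ := by
    -- Measurability of the derivative comes from writing it as an almost everywhere limit of
    -- difference quotients along a null sequence small enough that `s + u n` stays in `U`.
    let u : ℕ → ℂ := fun n => ((r / 2 / (n + 1 : ℝ) / 2 : ℝ) : ℂ)
    have hu0 : ∀ n, u n ≠ 0 := fun n => by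
      simp only [u, ne_eq, Complex.ofReal_eq_zero]; positivity
    have hut : Tendsto u atTop (𝓝[≠] 0) := by
      refine tendsto_nhdsWithin_iff.2 ⟨?_, Eventually.of_forall hu0⟩
      have : Tendsto (fun n : ℕ => r / 2 / (n + 1 : ℝ) / 2) atTop (𝓝 0) := by
        have h := (tendsto_one_div_add_atTop_nhds_zero_nat (𝕜 := ℝ)).const_mul (r / 4)
        rw [mul_zero] at h
        refine h.congr fun n => ?_
        field_simp; ring
      have h := (Complex.continuous_ofReal.tendsto 0).comp this
      rw [Complex.ofReal_zero] at h
      exact h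
    have hmem : ∀ n, s + u n ∈ U := fun n => by
      refine (hrV ?_).2
      rw [Metric.mem_ball, dist_eq_norm, add_sub_cancel_left]
      simp only [u]
      rw [Complex.norm_real, Real.norm_of_nonneg (by positivity)]
      rw [div_div, div_lt_iff₀ (by positivity)]
      have : (0 : ℝ) ≤ n := n.cast_nonneg
      nlinarith
    refine aestronglyMeasurable_of_tendsto_ae atTop
      (f := fun n x => (u n)⁻¹ • (f (s + u n) x - f s x)) (fun n => ?_) ?_
    · exact ((hmeas _ (hmem n)).sub (hmeas s hs)).const_smul ((u n)⁻¹)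
    · filter_upwards [hder] with x hx
      exact (hasDerivAt_iff_tendsto_slope_zero.1 (hx s hsb)).comp hut
  refine (hasDerivAt_integral_of_dominated_loc_of_deriv_le (bound := fun x => b x / (r / 4))
    (Metric.ball_mem_nhds s (by positivity : 0 < r / 2)) ?_ ?_ hmeas' hbound (hbi.div_const _)
    hder).2.differentiableAt.differentiableWithinAt
  · filter_upwards [hU.mem_nhds hs] with z hz using hmeas z hz
  · refine hbi.mono' (hmeas s hs) ?_
    filter_upwards [hb] with x hx using hx s (mem_of_mem_nhds hV)

/-! ### The polylogarithm $\mathrm{Li}_s(e^{-t})$ for $t>0$. -/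

/-- `polylogExp s t = ∑_{n ≥ 1} n ^ (-s) e ^ (-n t)`, the polylogarithm `Li_s (e ^ (-t))`. -/
noncomputable def polylogExp (s : ℂ) (t : ℝ) : ℂ :=
  ∑' n : ℕ+, (n : ℂ) ^ (-s) * (Real.exp (-(n : ℝ) * t) : ℂ)

theorem norm_pnat_cpow (n : ℕ+) (s : ℂ) : ‖(n : ℂ) ^ s‖ = (n : ℝ) ^ s.re :=
  Complex.norm_natCast_cpow_of_pos n.pos s

theorem norm_pnat_cpow_neg_le (n : ℕ+) {s : ℂ} {m : ℕ} (hs : -(m : ℝ) ≤ s.re) :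
    ‖(n : ℂ) ^ (-s)‖ ≤ (n : ℝ) ^ m := by
  rw [norm_pnat_cpow, Complex.neg_re, ← Real.rpow_natCast]
  exact Real.rpow_le_rpow_of_exponent_le (by exact_mod_cast n.2) (by linarith)

theorem summable_pnat_pow_mul_exp (m : ℕ) {d : ℝ} (hd : 0 < d) :
    Summable fun n : ℕ+ => (n : ℝ) ^ m * Real.exp (-(n : ℝ) * d) := by
  have h := (Real.summable_pow_mul_exp_neg_nat_mul m hd).comp_injective PNat.coe_injective
  refine h.congr fun n => ?_
  simp only [Function.comp]
  ring_nf

theorem norm_polylogExp_term_le (n : ℕ+) {s : ℂ} {m : ℕ} (hs : -(m : ℝ) ≤ s.re) {d t : ℝ}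
    (hdt : d ≤ t) :
    ‖(n : ℂ) ^ (-s) * (Real.exp (-(n : ℝ) * t) : ℂ)‖ ≤ (n : ℝ) ^ m * Real.exp (-(n : ℝ) * d) := by
  rw [norm_mul, Complex.norm_real, Real.norm_of_nonneg (Real.exp_pos _).le]
  have hn : (0 : ℝ) < n := by exact_mod_cast n.pos
  gcongr ?_ * ?_
  · exact norm_pnat_cpow_neg_le n hs
  · apply Real.exp_le_exp.2
    nlinarith

theorem summable_polylogExp (s : ℂ) {t : ℝ} (ht : 0 < t) :
    Summable fun n : ℕ+ => (n : ℂ) ^ (-s) * (Real.exp (-(n : ℝ) * t) : ℂ) := by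
  obtain ⟨m, hm⟩ := exists_nat_ge (-s.re)
  exact .of_norm_bounded (summable_pnat_pow_mul_exp m ht)
    fun n => norm_polylogExp_term_le n (by linarith) le_rfl

theorem hasSum_polylogExp (s : ℂ) {t : ℝ} (ht : 0 < t) :
    HasSum (fun n : ℕ+ => (n : ℂ) ^ (-s) * (Real.exp (-(n : ℝ) * t) : ℂ)) (polylogExp s t) :=
  (summable_polylogExp s ht).hasSum

/-- Exponential decay of the polylogarithm, uniform for `s` in a right half plane. -/
theorem exists_norm_polylogExp_le (m : ℕ) {d : ℝ} (hd : 0 < d) :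
    ∃ C : ℝ, 0 ≤ C ∧ ∀ s : ℂ, -(m : ℝ) ≤ s.re → ∀ t : ℝ, d ≤ t →
      ‖polylogExp s t‖ ≤ C * Real.exp (-t) := by
  -- The factor $e^d$ comes from $(n-1)(t-d)\ge0$, that is, $e^{-nt}\le e^{d}e^{-nd}e^{-t}$.
  have hsum := (summable_pnat_pow_mul_exp m hd).mul_left (Real.exp d)
  refine ⟨∑' n : ℕ+, Real.exp d * ((n : ℝ) ^ m * Real.exp (-(n : ℝ) * d)),
    tsum_nonneg fun n => by positivity, fun s hs t ht => ?_⟩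
  refine tsum_of_norm_bounded (hsum.hasSum.mul_right (Real.exp (-t))) fun n => ?_
  refine (norm_polylogExp_term_le n hs le_rfl).trans ?_
  have hn : (1 : ℝ) ≤ n := by exact_mod_cast n.2
  have hexp : Real.exp d * ((n : ℝ) ^ m * Real.exp (-(n : ℝ) * d)) * Real.exp (-t)
      = (n : ℝ) ^ m * Real.exp (d + -(n : ℝ) * d + -t) := by
    rw [Real.exp_add, Real.exp_add]; ring
  rw [hexp]
  gcongr
  nlinarith

theorem hasDerivAt_polylogExp (s : ℂ) {t : ℝ} (ht : 0 < t) :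
    HasDerivAt (polylogExp s) (-polylogExp (s - 1) t) t := by
  obtain ⟨m, hm⟩ := exists_nat_ge (-(s - 1).re)
  have hd : 0 < t / 2 := by positivity
  have key := hasDerivAt_tsum_of_isPreconnected
    (g := fun (n : ℕ+) (x : ℝ) => (n : ℂ) ^ (-s) * (Real.exp (-(n : ℝ) * x) : ℂ))
    (g' := fun (n : ℕ+) (x : ℝ) => -((n : ℂ) ^ (-(s - 1)) * (Real.exp (-(n : ℝ) * x) : ℂ)))
    (summable_pnat_pow_mul_exp m hd) isOpen_Ioi isPreconnected_Ioi (t := Ioi (t / 2)) (y₀ := t)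
    (fun n y _ => ?_) (fun n y hy => ?_) (mem_Ioi.2 (by linarith)) (summable_polylogExp s ht)
    (mem_Ioi.2 (by linarith : t / 2 < t))
  · rw [tsum_neg] at key
    exact key
  · have h1 : HasDerivAt (fun x : ℝ => Real.exp (-(n : ℝ) * x))
        (Real.exp (-(n : ℝ) * y) * (-(n : ℝ))) y := by
      simpa using ((hasDerivAt_id y).const_mul (-(n : ℝ))).exp
    have h2 := (h1.ofReal_comp).const_mul ((n : ℂ) ^ (-s))
    convert! h2 using 1
    have hn : (n : ℂ) ≠ 0 := by exact_mod_cast n.ne_zero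
    rw [neg_sub, sub_eq_add_neg, add_comm, Complex.cpow_add _ _ hn, Complex.cpow_one]
    push_cast
    ring
  · rw [norm_neg]
    exact norm_polylogExp_term_le n (by linarith) (mem_Ioi.1 hy).le

theorem continuousOn_polylogExp (s : ℂ) : ContinuousOn (polylogExp s) (Ioi 0) :=
  fun _ ht => (hasDerivAt_polylogExp s ht).continuousAt.continuousWithinAt

theorem differentiable_polylogExp {t : ℝ} (ht : 0 < t) :
    Differentiable ℂ fun s => polylogExp s t := by
  intro s
  obtain ⟨m, hm⟩ := exists_nat_ge (-(s.re - 1))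
  have hU : IsOpen {z : ℂ | s.re - 1 < z.re} := isOpen_lt continuous_const Complex.continuous_re
  refine (Complex.differentiableOn_tsum_of_summable_norm (summable_pnat_pow_mul_exp m ht)
    (fun n => ?_) hU (fun n z hz => norm_polylogExp_term_le n ?_ le_rfl)).differentiableAt
    (hU.mem_nhds (by simp))
  · have hn : (n : ℂ) ≠ 0 := by exact_mod_cast n.ne_zero
    refine Differentiable.differentiableOn ?_
    exact (differentiable_id.neg.const_cpow (Or.inl hn)).mul_const _
  · have : s.re - 1 < z.re := hz
    linarith

theorem polylogExp_zero {t : ℝ} (ht : 0 < t) :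
    polylogExp 0 t = ((1 / (Real.exp t - 1) : ℝ) : ℂ) := by
  have h1 : HasSum (fun n : ℕ => Real.exp (-t) * Real.exp (-t) ^ n)
      (Real.exp (-t) * (1 - Real.exp (-t))⁻¹) :=
    (hasSum_geometric_of_lt_one (Real.exp_pos _).le (by simpa using ht)).mul_left _
  have h2 := (Equiv.pnatEquivNat.hasSum_iff (f := fun n : ℕ => Real.exp (-t) * Real.exp (-t) ^ n)
    (a := Real.exp (-t) * (1 - Real.exp (-t))⁻¹)).2 h1
  have h3 := h2.mapL Complex.ofRealCLM
  rw [polylogExp]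
  refine (HasSum.tsum_eq (a := ((1 / (Real.exp t - 1) : ℝ) : ℂ)) ?_).trans ?_
  · convert! h3 using 1
    · ext n
      simp only [neg_zero, Complex.cpow_zero, one_mul, Function.comp, Complex.ofRealCLM_apply]
      congr 1
      rw [← Real.exp_nat_mul, ← Real.exp_add]
      congr 1
      have : (n : ℝ) = (n.natPred : ℝ) + 1 := by
        exact_mod_cast (PNat.natPred_add_one n).symm
      simp only [Equiv.pnatEquivNat_apply]
      rw [this]; ring
    · rw [Complex.ofRealCLM_apply]
      congr 1
      rw [Real.exp_neg]
      have h4 : Real.exp t - 1 ≠ 0 := by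
        have := Real.add_one_lt_exp ht.ne'
        intro h; linarith
      have h5 := Real.exp_pos t
      field_simp
  · rfl

/-! ### The regular part, and its behaviour at nonpositive integers. -/

/-- The polylogarithm `Li_s (e ^ (-t))` minus its singular part `Γ (1 - s) t ^ (s - 1)`. -/
noncomputable def polylogReg (s : ℂ) (t : ℝ) : ℂ :=
  polylogExp s t - Complex.Gamma (1 - s) * (t : ℂ) ^ (s - 1)

theorem hasDerivAt_ofReal_cpow_const_of_pos (a : ℂ) {t : ℝ} (ht : 0 < t) :
    HasDerivAt (fun x : ℝ => (x : ℂ) ^ a) (a * (t : ℂ) ^ (a - 1)) t := by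
  have h1 : HasDerivAt (fun x : ℂ => x ^ a) (a * (t : ℂ) ^ (a - 1) * 1) (t : ℂ) :=
    (hasDerivAt_id (t : ℂ)).cpow_const (Complex.ofReal_mem_slitPlane.2 ht)
  simpa using h1.comp_ofReal

/-- The functional equation $\Gamma(2-s)=(1-s)\Gamma(1-s)$ makes the singular term obey the same
rule, differentiation lowering $s$ by one with a sign, as the polylogarithm itself. -/
theorem hasDerivAt_polylogReg {s : ℂ} (hs : s ≠ 1) {t : ℝ} (ht : 0 < t) :
    HasDerivAt (polylogReg s) (-polylogReg (s - 1) t) t := by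
  refine ((hasDerivAt_polylogExp s ht).sub
    ((hasDerivAt_ofReal_cpow_const_of_pos (s - 1) ht).const_mul (Complex.Gamma (1 - s)))).congr_deriv ?_
  have h : Complex.Gamma (1 - (s - 1)) = (1 - s) * Complex.Gamma (1 - s) := by
    rw [← Complex.Gamma_add_one _ (sub_ne_zero.2 hs.symm)]
    congr 1; ring
  rw [polylogReg, h]
  ring

theorem continuousOn_polylogReg (s : ℂ) : ContinuousOn (polylogReg s) (Ioi 0) := by
  refine (continuousOn_polylogExp s).sub (continuousOn_const.mul fun t ht => ?_)
  exact (hasDerivAt_ofReal_cpow_const_of_pos _ ht).continuousAt.continuousWithinAt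

theorem polylogReg_zero {t : ℝ} (ht : 0 < t) :
    polylogReg 0 t = ((1 / (Real.exp t - 1) - 1 / t : ℝ) : ℂ) := by
  rw [polylogReg, polylogExp_zero ht]
  simp [Complex.cpow_neg_one]

/-- With $q(x)=(e^x-1)/x$ one has $1/(e^x-1)-1/x=-\frac{(q(x)-1)/x}{q(x)}$, a quotient of analytic
divided differences with $q(0)=1$. The other orders follow by differentiating. -/
theorem exists_analyticAt_eq_polylogReg (M : ℕ) :
    ∃ h : ℝ → ℂ, AnalyticAt ℝ h 0 ∧ ∀ᶠ x in 𝓝[>] (0 : ℝ), polylogReg (-(M : ℂ)) x = h x := by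
  induction M with
  | zero =>
    let q : ℝ → ℝ := dslope Real.exp 0
    have hq : AnalyticAt ℝ q 0 := by
      obtain ⟨p, hp⟩ := analyticAt_rexp (x := 0)
      exact ⟨_, hp.has_fpower_series_dslope_fslope⟩
    have hq1 : AnalyticAt ℝ (dslope q 0) 0 := by
      obtain ⟨p, hp⟩ := hq
      exact ⟨_, hp.has_fpower_series_dslope_fslope⟩
    have hq0 : q 0 = 1 := by simp [q, dslope_same]
    refine ⟨fun x => ((-(dslope q 0 x) / q x : ℝ) : ℂ), ?_, ?_⟩
    · have h1 : AnalyticAt ℝ (fun x => -(dslope q 0 x) / q x) 0 :=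
        hq1.neg.div hq (by rw [hq0]; exact one_ne_zero)
      exact (Complex.ofRealCLM.analyticAt _).comp h1
    · filter_upwards [self_mem_nhdsWithin] with x hx
      have hx : 0 < x := hx
      have e1 : q x = (Real.exp x - 1) / x := by
        simp [q, dslope_of_ne _ hx.ne', slope_def_field]
      have e2 : dslope q 0 x = ((Real.exp x - 1) / x - 1) / x := by
        rw [dslope_of_ne _ hx.ne', slope_def_field, e1, hq0, sub_zero]
      have h4 : Real.exp x - 1 ≠ 0 := by
        have := Real.add_one_lt_exp hx.ne'
        intro h; linarith
      rw [Nat.cast_zero, neg_zero, polylogReg_zero hx, e1, e2]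
      congr 1
      field_simp
      ring
  | succ M ih =>
    obtain ⟨h, hh, he⟩ := ih
    refine ⟨-deriv h, hh.deriv.neg, ?_⟩
    rw [eventually_nhdsWithin_iff] at he ⊢
    filter_upwards [he.eventually_nhds] with x hx hx0
    have hx0 : 0 < x := hx0
    have h1 : polylogReg (-(M : ℂ)) =ᶠ[𝓝 x] h := by
      filter_upwards [hx, Ioi_mem_nhds hx0] with y hy hy0 using hy hy0
    have h2 : -(M : ℂ) ≠ 1 := by
      intro h
      have := congrArg Complex.re h
      simp at this
      linarith [(Nat.cast_nonneg M : (0 : ℝ) ≤ M)]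
    have h3 := (hasDerivAt_polylogReg h2 hx0).deriv
    rw [h1.deriv_eq] at h3
    rw [Pi.neg_apply, h3, neg_neg]
    congr 1
    push_cast
    ring

/-- Near $0$ analyticity gives boundedness. Away from $0$ the polylogarithm decays exponentially, so
the subtracted term $M!\,x^{-M-1}$ dictates the rate. -/
theorem exists_norm_polylogReg_neg_nat_le (M : ℕ) :
    ∃ C : ℝ, 0 ≤ C ∧ ∀ x : ℝ, 0 < x → ‖polylogReg (-(M : ℂ)) x‖ ≤ C / (1 + x) ^ (M + 1) := by
  obtain ⟨h, hh, he⟩ := exists_analyticAt_eq_polylogReg M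
  have hb : ∀ᶠ x in 𝓝[>] (0 : ℝ), ‖polylogReg (-(M : ℂ)) x‖ ≤ ‖h 0‖ + 1 := by
    have h1 : ∀ᶠ x in 𝓝 (0 : ℝ), ‖h x‖ < ‖h 0‖ + 1 :=
      hh.continuousAt.norm.eventually_lt continuousAt_const (by simp)
    filter_upwards [he, h1.filter_mono nhdsWithin_le_nhds] with x hx hx1
    rw [hx]; exact hx1.le
  obtain ⟨d, hd, hdb⟩ := mem_nhdsGT_iff_exists_Ioo_subset.1 hb
  have hd : 0 < d := hd
  obtain ⟨C1, hC1, hL⟩ := exists_norm_polylogExp_le M hd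
  refine ⟨(‖h 0‖ + 1) * (1 + d) ^ (M + 1) + (C1 * (Real.exp 1 * (M + 1).factorial) +
    M.factorial * ((1 + d) / d) ^ (M + 1)), by positivity, fun x hx => ?_⟩
  rw [le_div_iff₀ (by positivity), add_mul]
  rcases lt_or_ge x d with hxd | hxd
  · have h1 : ‖polylogReg (-(M : ℂ)) x‖ ≤ ‖h 0‖ + 1 := hdb ⟨hx, hxd⟩
    have h2 : (1 + x) ^ (M + 1) ≤ (1 + d) ^ (M + 1) := by gcongr
    calc _ ≤ (‖h 0‖ + 1) * (1 + d) ^ (M + 1) := by gcongr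
      _ ≤ _ := by
        have : 0 ≤ C1 * (Real.exp 1 * (M + 1).factorial) +
          M.factorial * ((1 + d) / d) ^ (M + 1) := by positivity
        linarith
  · have h1 := hL (-(M : ℂ)) (by simp) x hxd
    have h2 : Real.exp (-x) * (1 + x) ^ (M + 1) ≤ Real.exp 1 * (M + 1).factorial := by
      have := Real.pow_div_factorial_le_exp (1 + x) (by linarith) (M + 1)
      rw [div_le_iff₀ (by positivity), Real.exp_add] at this
      calc _ ≤ Real.exp (-x) * (Real.exp 1 * Real.exp x * (M + 1).factorial) := by gcongr
        _ = Real.exp 1 * (M + 1).factorial * (Real.exp (-x) * Real.exp x) := by ring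
        _ = _ := by rw [← Real.exp_add]; simp
    have h3 : ‖Complex.Gamma (1 - -(M : ℂ)) * (x : ℂ) ^ (-(M : ℂ) - 1)‖ * (1 + x) ^ (M + 1)
        ≤ M.factorial * ((1 + d) / d) ^ (M + 1) := by
      rw [sub_neg_eq_add, add_comm, Complex.Gamma_nat_eq_factorial, norm_mul, Complex.norm_natCast,
        Complex.norm_cpow_eq_rpow_re_of_pos hx]
      have : (-(M : ℂ) - 1).re = -((M + 1 : ℕ) : ℝ) := by simp; ring
      rw [this, Real.rpow_neg hx.le, Real.rpow_natCast, mul_assoc, ← div_eq_inv_mul, ← div_pow]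
      gcongr _ * ?_ ^ _
      rw [div_le_div_iff₀ hx hd]
      linarith
    calc ‖polylogReg (-(M : ℂ)) x‖ * (1 + x) ^ (M + 1)
        ≤ (C1 * Real.exp (-x) + ‖Complex.Gamma (1 - -(M : ℂ)) * (x : ℂ) ^ (-(M : ℂ) - 1)‖)
          * (1 + x) ^ (M + 1) := by
          gcongr
          exact (norm_sub_le _ _).trans (by gcongr)
      _ = C1 * (Real.exp (-x) * (1 + x) ^ (M + 1)) +
        ‖Complex.Gamma (1 - -(M : ℂ)) * (x : ℂ) ^ (-(M : ℂ) - 1)‖ * (1 + x) ^ (M + 1) := by ring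
      _ ≤ C1 * (Real.exp 1 * (M + 1).factorial) + M.factorial * ((1 + d) / d) ^ (M + 1) := by
          gcongr
      _ ≤ _ := by
        have : 0 ≤ (‖h 0‖ + 1) * (1 + d) ^ (M + 1) := by positivity
        nlinarith

/-! ### Weyl fractional integration: from nonpositive integer order to complex order. -/

theorem integrableOn_cpow_mul_exp_neg_mul {a : ℂ} (ha : 0 < a.re) {r : ℝ} (hr : 0 < r) :
    IntegrableOn (fun x : ℝ => (x : ℂ) ^ (a - 1) * (Real.exp (-r * x) : ℂ)) (Ioi 0) := by
  have h := (integrableOn_rpow_mul_exp_neg_mul_rpow (s := a.re - 1) (p := 1) (by linarith)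
    one_pos hr)
  refine Integrable.mono' h ?_ ?_
  · refine ContinuousOn.aestronglyMeasurable (fun x hx => ?_) measurableSet_Ioi
    have h1 : ContinuousAt (fun x : ℝ => (x : ℂ) ^ (a - 1)) x :=
      (hasDerivAt_ofReal_cpow_const_of_pos _ hx).continuousAt
    exact (h1.mul (by fun_prop)).continuousWithinAt
  · filter_upwards [ae_restrict_mem measurableSet_Ioi] with x hx
    rw [norm_mul, Complex.norm_cpow_eq_rpow_re_of_pos hx, Complex.norm_real,
      Real.norm_of_nonneg (Real.exp_pos _).le]
    simp

theorem integral_cpow_mul_exp_neg_mul {a : ℂ} (ha : 0 < a.re) {r : ℝ} (hr : 0 < r) :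
    ∫ x in Ioi (0 : ℝ), (x : ℂ) ^ (a - 1) * (Real.exp (-r * x) : ℂ)
      = (r : ℂ) ^ (-a) * Complex.Gamma a := by
  have h := Complex.integral_cpow_mul_exp_neg_mul_Ioi ha hr
  rw [one_div, Complex.inv_cpow _ _ (by rw [Complex.arg_ofReal_of_nonneg hr.le]; exact Real.pi_pos.ne),
    ← Complex.cpow_neg] at h
  rw [← h]
  refine setIntegral_congr_fun measurableSet_Ioi fun x _ => ?_
  simp

theorem norm_cpow_mul_exp {a : ℂ} {r x : ℝ} (hx : 0 < x) :
    ‖(x : ℂ) ^ (a - 1) * (Real.exp (-r * x) : ℂ)‖ = x ^ (a.re - 1) * Real.exp (-r * x) := by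
  rw [norm_mul, Complex.norm_cpow_eq_rpow_re_of_pos hx, Complex.norm_real,
      Real.norm_of_nonneg (Real.exp_pos _).le]
  simp

/-- Mellin transform of `x ↦ Γ b (x + t) ^ (-b)`. -/
theorem hasMellin_add_cpow_neg {a b : ℂ} (ha : 0 < a.re) (hab : a.re < b.re) {t : ℝ}
    (ht : 0 < t) :
    HasMellin (fun x : ℝ => Complex.Gamma b * ((x + t : ℝ) : ℂ) ^ (-b)) a
      (Complex.Gamma a * (Complex.Gamma (b - a) * (t : ℂ) ^ (a - b))) := by
  let μ : Measure ℝ := volume.restrict (Ioi 0)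
  -- Writing $\Gamma(b)(x+t)^{-b}=\int_0^\infty y^{b-1}e^{-(x+t)y}\,dy$ and exchanging the integrals
  -- reduces the claim to two Gamma integrals.
  let F : ℝ → ℝ → ℂ := fun x y =>
    (x : ℂ) ^ (a - 1) * ((y : ℂ) ^ (b - 1) * (Real.exp (-(x + t) * y) : ℂ))
  have hF : ∀ x y, F x y = ((y : ℂ) ^ (b - 1) * (Real.exp (-t * y) : ℂ)) *
      ((x : ℂ) ^ (a - 1) * (Real.exp (-y * x) : ℂ)) := by
    intro x y
    have : Real.exp (-(x + t) * y) = Real.exp (-t * y) * Real.exp (-y * x) := by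
      rw [← Real.exp_add]; congr 1; ring
    simp only [F, this]
    push_cast
    ring
  have hb : 0 < b.re := ha.trans hab
  have hmeas : AEStronglyMeasurable (Function.uncurry F) (μ.prod μ) := by
    simp only [μ]
    rw [Measure.prod_restrict]
    refine ContinuousOn.aestronglyMeasurable (fun p hp => ?_)
      (measurableSet_Ioi.prod measurableSet_Ioi)
    have h1 : ContinuousAt (fun p : ℝ × ℝ => (p.1 : ℂ) ^ (a - 1)) p :=
      ContinuousAt.comp (f := Prod.fst) (g := fun x : ℝ => (x : ℂ) ^ (a - 1))
        (hasDerivAt_ofReal_cpow_const_of_pos _ hp.1).continuousAt continuousAt_fst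
    have h2 : ContinuousAt (fun p : ℝ × ℝ => (p.2 : ℂ) ^ (b - 1)) p :=
      ContinuousAt.comp (f := Prod.snd) (g := fun x : ℝ => (x : ℂ) ^ (b - 1))
        (hasDerivAt_ofReal_cpow_const_of_pos _ hp.2).continuousAt continuousAt_snd
    exact (h1.mul (h2.mul (by fun_prop))).continuousWithinAt
  have hint : Integrable (Function.uncurry F) (μ.prod μ) := by
    rw [integrable_prod_iff' hmeas]
    constructor
    · filter_upwards [ae_restrict_mem measurableSet_Ioi] with y hy
      simp only [Function.uncurry, hF]
      exact (integrableOn_cpow_mul_exp_neg_mul ha hy).const_mul _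
    · have h1 : Integrable (fun y : ℝ => Complex.Gamma (a.re : ℂ) *
          ((y : ℂ) ^ (((b.re - a.re : ℝ) : ℂ) - 1) * (Real.exp (-t * y) : ℂ))) μ :=
        (integrableOn_cpow_mul_exp_neg_mul (by simpa using hab) ht).const_mul _
      refine h1.norm.congr ?_
      filter_upwards [ae_restrict_mem measurableSet_Ioi] with y hy
      have hy : 0 < y := hy
      have h2 : ∫ x, ‖Function.uncurry F (x, y)‖ ∂μ = y ^ (b.re - 1) * Real.exp (-t * y) *
          (y ^ (-a.re) * Real.Gamma a.re) := by
        simp only [Function.uncurry, hF, norm_mul, integral_const_mul]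
        rw [← norm_mul, norm_cpow_mul_exp hy]
        congr 1
        have h3 := Real.integral_rpow_mul_exp_neg_mul_Ioi ha hy
        rw [one_div, Real.inv_rpow hy.le, ← Real.rpow_neg hy.le] at h3
        rw [← h3]
        refine setIntegral_congr_fun measurableSet_Ioi fun x hx => ?_
        rw [← norm_mul, norm_cpow_mul_exp hx, neg_mul]
      rw [h2, norm_mul, norm_cpow_mul_exp hy, Complex.Gamma_ofReal, Complex.norm_real,
        Real.norm_of_nonneg (Real.Gamma_pos_of_pos ha).le, Complex.ofReal_re]
      have : y ^ (b.re - a.re - 1) = y ^ (b.re - 1) * y ^ (-a.re) := by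
        rw [← Real.rpow_add hy]; congr 1; ring
      rw [this]; ring
  have hinner : ∀ x ∈ Ioi (0 : ℝ), ∫ y, F x y ∂μ =
      (x : ℂ) ^ (a - 1) • (Complex.Gamma b * ((x + t : ℝ) : ℂ) ^ (-b)) := by
    intro x hx
    have hx : 0 < x := hx
    simp only [F, integral_const_mul, smul_eq_mul]
    rw [integral_cpow_mul_exp_neg_mul hb (by positivity : 0 < x + t)]
    ring
  constructor
  · refine (hint.integral_prod_left).congr ?_
    filter_upwards [ae_restrict_mem measurableSet_Ioi] with x hx
    exact hinner x hx
  · rw [mellin, ← setIntegral_congr_fun measurableSet_Ioi hinner]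
    change ∫ x, ∫ y, F x y ∂μ ∂μ = _
    rw [integral_integral_swap hint]
    have h1 : ∀ y ∈ Ioi (0 : ℝ), ∫ x, F x y ∂μ =
        Complex.Gamma a * ((y : ℂ) ^ ((b - a) - 1) * (Real.exp (-t * y) : ℂ)) := by
      intro y hy
      have hy : 0 < y := hy
      simp only [hF, integral_const_mul]
      rw [integral_cpow_mul_exp_neg_mul ha hy]
      have : (y : ℂ) ^ ((b - a) - 1) = (y : ℂ) ^ (b - 1) * (y : ℂ) ^ (-a) := by
        rw [← Complex.cpow_add _ _ (by exact_mod_cast hy.ne')]; congr 1; ring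
      rw [this]; ring
    rw [setIntegral_congr_fun measurableSet_Ioi h1, integral_const_mul,
      integral_cpow_mul_exp_neg_mul (by simpa using hab) ht, neg_sub]
    ring

/-- Termwise, $\int_0^\infty x^{s+M-1}n^Me^{-n(x+t)}\,dx=\Gamma(s+M)n^{-s}e^{-nt}$. This transfers
information from order $-M$, where everything is elementary, to order $s$. -/
theorem mellin_polylogExp_add {s : ℂ} {M : ℕ} (hs : -(M : ℝ) < s.re) {t : ℝ} (ht : 0 < t) :
    mellin (fun x => polylogExp (-(M : ℂ)) (x + t)) (s + M)
      = Complex.Gamma (s + M) * polylogExp s t := by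
  have hsM : 0 < (s + M).re := by simp; linarith
  have h := hasSum_mellin (ι := ℕ+) (s := s + M)
    (a := fun n => (n : ℂ) ^ (-(-(M : ℂ))) * (Real.exp (-(n : ℝ) * t) : ℂ))
    (p := fun n => (n : ℝ)) (F := fun x => polylogExp (-(M : ℂ)) (x + t))
    (fun n => Or.inr (by exact_mod_cast n.pos)) hsM (fun x hx => ?_) ?_
  · refine h.unique ?_
    convert! (hasSum_polylogExp s ht).mul_left (Complex.Gamma (s + M)) using 2 with n
    have hn : (n : ℂ) ≠ 0 := by exact_mod_cast n.ne_zero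
    rw [neg_neg, Complex.ofReal_natCast, Complex.cpow_add _ _ hn, Complex.cpow_neg]
    have h1 : (n : ℂ) ^ s ≠ 0 := by simp [Complex.cpow_eq_zero_iff, hn]
    have h2 : (n : ℂ) ^ (M : ℂ) ≠ 0 := by simp [hn]
    field_simp
  · have hx : 0 < x := hx
    convert! hasSum_polylogExp (-(M : ℂ)) (add_pos hx ht) using 2 with n
    rw [mul_assoc, ← Complex.ofReal_mul, ← Real.exp_add]
    congr 3; ring
  · refine .of_nonneg_of_le (fun n => by positivity) (fun n => ?_)
      (summable_pnat_pow_mul_exp M ht)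
    have hn : (1 : ℝ) ≤ n := by exact_mod_cast n.2
    refine (div_le_self (norm_nonneg _) (Real.one_le_rpow hn hsM.le)).trans ?_
    exact norm_polylogExp_term_le n (by simp) le_rfl

/-- This is the convergence of the beta integral, read off from `hasMellin_add_cpow_neg` at $t=1$.
-/
theorem integrableOn_rpow_div_one_add_pow {c : ℝ} {M : ℕ} (hc : 0 < c) (hcM : c < M + 1) :
    IntegrableOn (fun x : ℝ => x ^ (c - 1) / (1 + x) ^ (M + 1)) (Ioi 0) := by
  have h := (hasMellin_add_cpow_neg (a := (c : ℂ)) (b := (M + 1 : ℂ)) (by simpa using hc)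
    (by simpa using hcM) one_pos).1
  have h1 := (Complex.Gamma_ne_zero_of_re_pos (s := (M + 1 : ℂ)) (by simp; positivity))
  have h2 := (h.const_smul (Complex.Gamma (M + 1 : ℂ))⁻¹).norm
  refine IntegrableOn.congr_fun h2 (fun x hx => ?_) measurableSet_Ioi
  have hx : 0 < x := hx
  simp only [smul_eq_mul]
  rw [inv_mul_cancel_left₀ h1, norm_mul, Complex.norm_cpow_eq_rpow_re_of_pos hx,
    Complex.norm_cpow_eq_rpow_re_of_pos (by positivity)]
  have h3 : (-(M + 1 : ℂ)).re = -((M + 1 : ℕ) : ℝ) := by simp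
  rw [h3, Real.rpow_neg (by positivity), Real.rpow_natCast, div_eq_mul_inv, add_comm x 1]
  simp

theorem norm_polylogReg_neg_nat_add_le {M : ℕ} {C : ℝ} (hC : 0 ≤ C)
    (h : ∀ x : ℝ, 0 < x → ‖polylogReg (-(M : ℂ)) x‖ ≤ C / (1 + x) ^ (M + 1)) {x t : ℝ}
    (hx : 0 < x) (ht : 0 ≤ t) : ‖polylogReg (-(M : ℂ)) (x + t)‖ ≤ C / (1 + x) ^ (M + 1) := by
  refine (h _ (by positivity)).trans ?_
  gcongr C / ?_ ^ _
  linarith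

/-- The Mellin transform of a translate of the regular part. -/
theorem hasMellin_polylogReg_add {s : ℂ} {M : ℕ} (hs : -(M : ℝ) < s.re) (hs1 : s.re < 1) {t : ℝ}
    (ht : 0 < t) :
    HasMellin (fun x => polylogReg (-(M : ℂ)) (x + t)) (s + M)
      (Complex.Gamma (s + M) * polylogReg s t) := by
  obtain ⟨C, hC, hb⟩ := exists_norm_polylogReg_neg_nat_le M
  have hsM : 0 < (s + M).re := by simp; linarith
  have hsM1 : (s + M).re < M + 1 := by simp; linarith
  have hconv : MellinConvergent (fun x => polylogReg (-(M : ℂ)) (x + t)) (s + M) := by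
    refine Integrable.mono' ((integrableOn_rpow_div_one_add_pow hsM hsM1).const_mul C) ?_ ?_
    · refine ContinuousOn.aestronglyMeasurable (fun x hx => ?_) measurableSet_Ioi
      have hx : 0 < x := hx
      refine ((hasDerivAt_ofReal_cpow_const_of_pos _ hx).continuousAt.smul ?_).continuousWithinAt
      exact ContinuousAt.comp (f := fun x => x + t) (g := polylogReg (-(M : ℂ)))
        ((continuousOn_polylogReg _).continuousAt (Ioi_mem_nhds (by positivity))) (by fun_prop)
    · filter_upwards [ae_restrict_mem measurableSet_Ioi] with x hx
      rw [norm_smul, Complex.norm_cpow_eq_rpow_re_of_pos hx, mul_div_left_comm]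
      rw [Complex.sub_re, Complex.one_re]
      exact mul_le_mul_of_nonneg_left (norm_polylogReg_neg_nat_add_le hC hb hx ht.le)
        (Real.rpow_nonneg (le_of_lt hx) _)
  have hbeta := hasMellin_add_cpow_neg (a := s + M) (b := M + 1) hsM (by simpa using hsM1) ht
  have heq : ∀ x ∈ Ioi (0 : ℝ), polylogExp (-(M : ℂ)) (x + t) = polylogReg (-(M : ℂ)) (x + t) +
      Complex.Gamma (M + 1) * ((x + t : ℝ) : ℂ) ^ (-(M + 1 : ℂ)) := by
    intro x _
    rw [polylogReg, sub_neg_eq_add, add_comm (1 : ℂ), neg_add', sub_add_cancel]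
  refine ⟨hconv, ?_⟩
  have h1 := (hasMellin_add hconv hbeta.1).2
  have h2 := mellin_polylogExp_add hs ht
  have h3 : mellin (fun x => polylogExp (-(M : ℂ)) (x + t)) (s + M) =
      mellin (fun x => polylogReg (-(M : ℂ)) (x + t) +
      Complex.Gamma (M + 1) * ((x + t : ℝ) : ℂ) ^ (-(M + 1 : ℂ))) (s + M) := by
    refine setIntegral_congr_fun measurableSet_Ioi fun x hx => ?_
    simp only [heq x hx]
  rw [h3, h1, hbeta.2] at h2
  rw [polylogReg, mul_sub, ← h2]
  have e1 : (M + 1 : ℂ) - (s + M) = 1 - s := by ring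
  have e2 : s + M - (M + 1 : ℂ) = s - 1 := by ring
  rw [e1, e2]
  ring

/-- Boundedness of the regular part on `(0, ∞)`, locally uniformly in `s`. -/
theorem exists_norm_polylogReg_le {s₀ : ℂ} (hs₀ : s₀.re < 1) :
    ∃ V ∈ 𝓝 s₀, ∃ C : ℝ, 0 ≤ C ∧ ∀ s ∈ V, ∀ t : ℝ, 0 < t → ‖polylogReg s t‖ ≤ C := by
  obtain ⟨M, hM⟩ := exists_nat_gt (1 - s₀.re)
  obtain ⟨C, hC, hb⟩ := exists_norm_polylogReg_neg_nat_le M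
  -- The exponents `c₁` and `c₂` lie in $(0,M+1)$ on either side of $\operatorname{Re}s_0+M$. For
  -- $s$ near $s_0$, $x^{\operatorname{Re}s+M-1}$ is at most the sum of the two powers: `c₁` serves
  -- $x\le1$ and `c₂` serves $x\ge1$.
  set c₁ : ℝ := s₀.re + M - 1 / 2 with hc₁
  set c₂ : ℝ := (s₀.re + 1) / 2 + M with hc₂
  have i1 := integrableOn_rpow_div_one_add_pow (c := c₁) (M := M) (by linarith) (by linarith)
  have i2 := integrableOn_rpow_div_one_add_pow (c := c₂) (M := M) (by linarith) (by linarith)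
  set B : ℝ := ∫ x in Ioi (0 : ℝ), C * (x ^ (c₁ - 1) / (1 + x) ^ (M + 1) +
    x ^ (c₂ - 1) / (1 + x) ^ (M + 1)) with hB
  have hG : ContinuousAt (fun s : ℂ => (Complex.Gamma (s + M))⁻¹) s₀ :=
    (Complex.differentiable_one_div_Gamma.continuous.comp (by fun_prop)).continuousAt
  have hGb : ∀ᶠ s in 𝓝 s₀, ‖(Complex.Gamma (s + M))⁻¹‖ < ‖(Complex.Gamma (s₀ + M))⁻¹‖ + 1 :=
    hG.norm.eventually_lt continuousAt_const (by simp)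
  have hre1 : ∀ᶠ s : ℂ in 𝓝 s₀, s₀.re - 1 / 2 < s.re :=
    continuousAt_const.eventually_lt Complex.continuous_re.continuousAt (by linarith)
  have hre2 : ∀ᶠ s : ℂ in 𝓝 s₀, s.re < (s₀.re + 1) / 2 :=
    Complex.continuous_re.continuousAt.eventually_lt continuousAt_const (by linarith)
  have hB0 : 0 ≤ B := setIntegral_nonneg measurableSet_Ioi fun x hx => by
    have hx : 0 < x := hx
    positivity
  refine ⟨_, hGb.and (hre1.and hre2), (‖(Complex.Gamma (s₀ + M))⁻¹‖ + 1) * B, by positivity,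
    fun s hs t ht => ?_⟩
  obtain ⟨h1, h2, h3⟩ := hs
  have hM' : (1 : ℝ) - s₀.re < M := hM
  have hsM : 0 < (s + M).re := by simp; linarith
  have hmel := hasMellin_polylogReg_add (s := s) (M := M) (by linarith) (by linarith) ht
  have hne : Complex.Gamma (s + M) ≠ 0 := Complex.Gamma_ne_zero_of_re_pos hsM
  have heq : polylogReg s t = (Complex.Gamma (s + M))⁻¹ *
      mellin (fun x => polylogReg (-(M : ℂ)) (x + t)) (s + M) := by
    rw [hmel.2, inv_mul_cancel_left₀ hne]
  rw [heq, norm_mul]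
  gcongr
  refine norm_integral_le_of_norm_le ((i1.add i2).const_mul C) ?_
  filter_upwards [ae_restrict_mem measurableSet_Ioi] with x hx
  have hx : 0 < x := hx
  rw [norm_smul, Complex.norm_cpow_eq_rpow_re_of_pos hx, mul_comm C, ← add_div,
    div_mul_eq_mul_div, mul_div_assoc]
  gcongr ?_ * ?_
  · have h4 : (s + M - 1).re = s.re + M - 1 := by simp
    rw [h4]
    rcases le_total x 1 with hx1 | hx1
    · have : x ^ (s.re + M - 1) ≤ x ^ (c₁ - 1) :=
        Real.rpow_le_rpow_of_exponent_ge hx hx1 (by linarith)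
      have := Real.rpow_nonneg hx.le (c₂ - 1)
      linarith
    · have : x ^ (s.re + M - 1) ≤ x ^ (c₂ - 1) :=
        Real.rpow_le_rpow_of_exponent_le hx1 (by linarith)
      have := Real.rpow_nonneg hx.le (c₁ - 1)
      linarith
  · exact norm_polylogReg_neg_nat_add_le hC hb hx ht.le

/-! ### The limit of the regular part at $0^+$ is $\zeta(s)$. -/

theorem hasSum_riemannZeta_pnat {s : ℂ} (hs : 1 < s.re) :
    HasSum (fun n : ℕ+ => (n : ℂ) ^ (-s)) (riemannZeta s) := by
  have h1 : Summable fun n : ℕ => 1 / (n : ℂ) ^ s := Complex.summable_one_div_nat_cpow.2 hs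
  have h2 := h1.hasSum
  rw [← zeta_eq_tsum_one_div_nat_cpow hs] at h2
  have h3 := (PNat.coe_injective.hasSum_iff (f := fun n : ℕ => 1 / (n : ℂ) ^ s)
    (a := riemannZeta s) (fun n hn => ?_)).2 h2
  · convert! h3 using 2 with n
    simp [Complex.cpow_neg]
  · have : n = 0 := by
      by_contra h0
      exact hn ⟨⟨n, Nat.pos_of_ne_zero h0⟩, rfl⟩
    have hs0 : s ≠ 0 := by rintro rfl; simp at hs; linarith
    simp [this, Complex.zero_cpow hs0]

theorem differentiableAt_Gamma_one_sub {s : ℂ} (hs : s.re < 1) :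
    DifferentiableAt ℂ (fun s => Complex.Gamma (1 - s)) s := by
  refine DifferentiableAt.comp (f := fun s => 1 - s) (g := Complex.Gamma) s
    (Complex.differentiableAt_Gamma _ fun m hm => ?_) (by fun_prop)
  have := congrArg Complex.re hm
  simp at this
  linarith [(Nat.cast_nonneg m : (0 : ℝ) ≤ m)]

theorem differentiableOn_polylogReg {t : ℝ} (ht : 0 < t) :
    DifferentiableOn ℂ (fun s => polylogReg s t) {s | s.re < 1} := by
  intro s hs
  refine DifferentiableAt.differentiableWithinAt ?_
  have h1 : DifferentiableAt ℂ (fun s : ℂ => (t : ℂ) ^ (s - 1)) s :=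
    (differentiableAt_id.sub_const _).const_cpow (Or.inl (by exact_mod_cast ht.ne'))
  exact (differentiable_polylogExp ht s).sub ((differentiableAt_Gamma_one_sub hs).mul h1)

theorem meromorphicAt_Gamma_one_sub (s : ℂ) :
    MeromorphicAt (fun s => Complex.Gamma (1 - s)) s := by
  have h : MeromorphicAt Complex.Gamma (1 - s) := (MeromorphicNFOn.Gamma (mem_univ _)).meromorphicAt
  exact h.comp_analyticAt (f := Complex.Gamma) (g := fun s => 1 - s) (by fun_prop)

theorem meromorphicAt_riemannZeta (s : ℂ) : MeromorphicAt riemannZeta s := by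
  have h : riemannZeta =ᶠ[𝓝[≠] s] fun s => (s - 1)⁻¹ + riemannZeta₀ s := by
    by_cases hs : s = 1
    · subst hs
      filter_upwards [self_mem_nhdsWithin] with z hz using riemannZeta_eq_inv_sub_add hz
    · filter_upwards [(isOpen_ne.mem_nhds hs : {z : ℂ | z ≠ 1} ∈ 𝓝 s) |> mem_nhdsWithin_of_mem_nhds]
        with z hz using riemannZeta_eq_inv_sub_add hz
  refine MeromorphicAt.congr ?_ h.symm
  have h1 : AnalyticAt ℂ riemannZeta₀ s := differentiable_riemannZeta₀.analyticAt s
  exact ((analyticAt_id.sub analyticAt_const).meromorphicAt.inv).add h1.meromorphicAt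

theorem tendsto_polylogReg_of_one_lt_re {s : ℂ} (hs : 1 < s.re) :
    Tendsto (polylogReg s) (𝓝[>] 0) (𝓝 (riemannZeta s)) := by
  have h1 : Tendsto (polylogExp s) (𝓝[>] 0) (𝓝 (riemannZeta s)) := by
    rw [← (hasSum_riemannZeta_pnat hs).tsum_eq]
    refine tendsto_tsum_of_dominated_convergence (bound := fun n : ℕ+ => (n : ℝ) ^ (-s).re)
      ?_ (fun n => ?_) ?_
    · simpa only [norm_pnat_cpow] using (hasSum_riemannZeta_pnat hs).summable.norm
    · have : Tendsto (fun t : ℝ => (n : ℂ) ^ (-s) * (Real.exp (-(n : ℝ) * t) : ℂ)) (𝓝 0)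
          (𝓝 ((n : ℂ) ^ (-s) * (Real.exp (-(n : ℝ) * 0) : ℂ))) :=
        Continuous.tendsto (by fun_prop) 0
      simp only [mul_zero, Real.exp_zero, Complex.ofReal_one, mul_one] at this
      exact this.mono_left nhdsWithin_le_nhds
    · filter_upwards [self_mem_nhdsWithin] with t ht n
      rw [norm_mul, norm_pnat_cpow, Complex.norm_real, Real.norm_of_nonneg (Real.exp_pos _).le]
      refine mul_le_of_le_one_right (by positivity) (Real.exp_le_one_iff.2 ?_)
      have ht : (0 : ℝ) < t := ht
      have : (0 : ℝ) ≤ n * t := by positivity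
      linarith
  have h2 : Tendsto (fun t : ℝ => (t : ℂ) ^ (s - 1)) (𝓝[>] 0) (𝓝 0) := by
    rw [tendsto_zero_iff_norm_tendsto_zero]
    have h3 : Tendsto (fun t : ℝ => t ^ (s.re - 1)) (𝓝[>] 0) (𝓝 0) := by
      have := (Real.continuousAt_rpow_const 0 (s.re - 1) (Or.inr (by linarith))).tendsto
      rw [Real.zero_rpow (by linarith)] at this
      exact this.mono_left nhdsWithin_le_nhds
    refine h3.congr' ?_
    filter_upwards [self_mem_nhdsWithin] with t ht
    rw [Complex.norm_cpow_eq_rpow_re_of_pos ht]; simp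
  simpa [polylogReg] using! h1.sub (h2.const_mul (Complex.Gamma (1 - s)))

theorem integrableOn_polylogReg {s : ℂ} (hs : s.re < 1) :
    IntegrableOn (polylogReg s) (Ioc 0 1) := by
  obtain ⟨V, hV, C, hC, hb⟩ := exists_norm_polylogReg_le hs
  refine Integrable.mono' (g := fun _ => C) (integrableOn_const (by simp)) ?_ ?_
  · exact ((continuousOn_polylogReg s).mono fun x hx => hx.1).aestronglyMeasurable
      measurableSet_Ioc
  · filter_upwards [ae_restrict_mem measurableSet_Ioc] with x hx
      using hb s (mem_of_mem_nhds hV) x hx.1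

/-- Integrate the derivative from $t$ to $1$: the integrand has order $s-1$, with real part below
$1$, so it is bounded near $0$. The limit gets a formula meromorphic on all of
$\operatorname{Re}s<2$, a region that meets $\operatorname{Re}s>1$. -/
theorem tendsto_polylogReg_integral {s : ℂ} (hs : s.re < 2) (hs1 : s ≠ 1) :
    Tendsto (polylogReg s) (𝓝[>] 0)
      (𝓝 (polylogReg s 1 + ∫ u in (0 : ℝ)..1, polylogReg (s - 1) u)) := by
  have hint : IntervalIntegrable (polylogReg (s - 1)) volume 0 1 := by
    rw [intervalIntegrable_iff_integrableOn_Ioc_of_le zero_le_one]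
    exact integrableOn_polylogReg (by simp; linarith)
  have h1 : ∀ᶠ t in 𝓝[>] (0 : ℝ), polylogReg s 1 + ∫ u in t..1, polylogReg (s - 1) u
      = polylogReg s t := by
    filter_upwards [Ioo_mem_nhdsGT (zero_lt_one (α := ℝ))] with t ht
    have h2 := intervalIntegral.integral_eq_sub_of_hasDerivAt (a := t) (b := 1)
      (f := polylogReg s) (f' := fun u => -polylogReg (s - 1) u) (fun u hu => ?_) ?_
    · rw [intervalIntegral.integral_neg] at h2
      linear_combination -h2
    · rw [uIcc_of_le ht.2.le] at hu
      exact hasDerivAt_polylogReg hs1 (ht.1.trans_le hu.1)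
    · refine (hint.mono_set ?_).neg
      rw [uIcc_of_le ht.2.le, uIcc_of_le zero_le_one]
      exact Icc_subset_Icc_left ht.1.le
  refine Tendsto.congr' h1 (tendsto_const_nhds.add ?_)
  have h3 := intervalIntegral.continuousOn_primitive_interval_left (μ := volume) (a := 0) (b := 1)
    (f := polylogReg (s - 1)) (by
      rw [uIcc_of_le zero_le_one, integrableOn_Icc_iff_integrableOn_Ioc]
      exact integrableOn_polylogReg (by simp; linarith))
  have h4 := h3 0 (by simp)
  refine h4.tendsto.mono_left ?_
  rw [uIcc_of_le zero_le_one, nhdsWithin_Icc_eq_nhdsGE zero_lt_one]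
  exact nhdsWithin_mono _ Ioi_subset_Ici_self

/-- On $1<\operatorname{Re}s<2$ the limit is $\zeta(s)$ by dominated convergence. The integral
formula for the limit and $\zeta$ are both meromorphic on $\operatorname{Re}s<2$, so the identity
theorem carries the equality to the left. -/
theorem tendsto_polylogReg {s : ℂ} (hs : s.re < 1) :
    Tendsto (polylogReg s) (𝓝[>] 0) (𝓝 (riemannZeta s)) := by
  have hs1 : s ≠ 1 := by rintro rfl; simp at hs
  let e : ℂ → ℂ := fun s => polylogReg s 1 + ∫ u in (0 : ℝ)..1, polylogReg (s - 1) u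
  let U : Set ℂ := {s | s.re < 2}
  have hU : IsOpen U := isOpen_lt Complex.continuous_re continuous_const
  have hUc : IsPreconnected U := (convex_halfSpace_re_lt 2).isPreconnected
  have hI : DifferentiableOn ℂ (fun s => ∫ u in (0 : ℝ)..1, polylogReg (s - 1) u) U := by
    simp only [intervalIntegral.integral_of_le zero_le_one]
    refine differentiableOn_integral_of_locally_dominated hU (fun s hs => ?_) ?_ fun s hs => ?_
    · have hs : s.re < 2 := hs
      exact (integrableOn_polylogReg (s := s - 1) (by simp; linarith)).1
    · filter_upwards [ae_restrict_mem measurableSet_Ioc] with t ht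
      refine (differentiableOn_polylogReg ht.1).comp
        (f := fun s : ℂ => s - 1) (by fun_prop) fun s hs => ?_
      have hs : s.re < 2 := hs
      simp; linarith
    · have hs : s.re < 2 := hs
      obtain ⟨V, hV, C, hC, hb⟩ := exists_norm_polylogReg_le (s₀ := s - 1) (by simp; linarith)
      refine ⟨(fun z => z - 1) ⁻¹' V, ?_, fun _ => C, integrableOn_const (by simp), ?_⟩
      · exact ContinuousAt.preimage_mem_nhds (by fun_prop) hV
      · filter_upwards [ae_restrict_mem measurableSet_Ioc] with t ht z hz using hb _ hz t ht.1
  have hP : MeromorphicOn (fun s => polylogReg s 1) U := by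
    intro s _
    have h1 : AnalyticAt ℂ (fun s => polylogExp s 1) s :=
      (differentiable_polylogExp one_pos).analyticAt s
    simpa [polylogReg] using! h1.meromorphicAt.sub (meromorphicAt_Gamma_one_sub s)
  have he : MeromorphicOn e U := fun s hs =>
    (hP s hs).add ((hI.analyticAt (hU.mem_nhds hs)).meromorphicAt)
  have hz : MeromorphicOn riemannZeta U := fun s _ => meromorphicAt_riemannZeta s
  have hloc : e =ᶠ[𝓝[≠] (3 / 2 : ℂ)] riemannZeta := by
    have h1 : {s : ℂ | 1 < s.re ∧ s.re < 2} ∈ 𝓝 (3 / 2 : ℂ) := by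
      refine ((isOpen_lt continuous_const Complex.continuous_re).inter hU).mem_nhds ?_
      constructor <;> simp only [mem_ofPred_eq, U] <;> norm_num
    filter_upwards [mem_nhdsWithin_of_mem_nhds h1] with z hz
    refine tendsto_nhds_unique (tendsto_polylogReg_integral hz.2 ?_)
      (tendsto_polylogReg_of_one_lt_re hz.1)
    rintro rfl
    simp at hz
  have h3 : (3 / 2 : ℂ) ∈ U := by simp [U]; norm_num
  have hsU : s ∈ U := by simp [U]; linarith
  have h4 := he.eventuallyEq_nhdsNE_of_isPreconnected hz hUc h3 hsU hloc
  have hec : ContinuousAt e s := by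
    refine ContinuousAt.add ?_ (hI.differentiableAt (hU.mem_nhds hsU)).continuousAt
    exact ((differentiableOn_polylogReg one_pos).differentiableAt
      ((isOpen_lt Complex.continuous_re continuous_const).mem_nhds hs)).continuousAt
  have h5 : e s = riemannZeta s :=
    ((hec.eventuallyEq_nhds_iff_eventuallyEq_nhdsNE
      (differentiableAt_riemannZeta hs1).continuousAt).1 h4).eq_of_nhds
  rw [← h5]
  exact tendsto_polylogReg_integral (by linarith) hs1

/-! ### Expansion of the polylogarithm at $0$ with uniform remainder. -/

/-- A function vanishing at `0⁺` whose derivative is `O(x ^ k)` is `O(x ^ (k + 1))`. -/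
theorem norm_le_of_hasDerivAt_of_tendsto_zero {f f' : ℝ → ℂ} {C : ℝ} (hC : 0 ≤ C) {k : ℕ}
    (hf : ∀ x, 0 < x → HasDerivAt f (f' x) x) (hf' : ∀ x, 0 < x → ‖f' x‖ ≤ C * x ^ k)
    (h0 : Tendsto f (𝓝[>] 0) (𝓝 0)) {x : ℝ} (hx : 0 < x) : ‖f x‖ ≤ C * x ^ (k + 1) := by
  have h1 : ∀ᶠ y in 𝓝[>] (0 : ℝ), ‖f x - f y‖ ≤ C * x ^ (k + 1) := by
    filter_upwards [Ioo_mem_nhdsGT hx] with y hy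
    have h2 := (convex_Icc y x).norm_image_sub_le_of_norm_hasDerivWithin_le (f := f) (f' := f')
      (C := C * x ^ k) (x := y) (y := x)
      (fun z hz => (hf z (hy.1.trans_le hz.1)).hasDerivWithinAt) (fun z hz => ?_)
      (left_mem_Icc.2 hy.2.le) (right_mem_Icc.2 hy.2.le)
    · refine h2.trans ?_
      rw [pow_succ, ← mul_assoc, Real.norm_of_nonneg (by linarith [hy.2])]
      gcongr
      linarith [hy.1]
    · have hz0 := hy.1.trans_le hz.1
      refine (hf' z hz0).trans ?_
      gcongr
      exact hz.2
  have h3 := (tendsto_const_nhds (x := f x)).sub h0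
  rw [sub_zero] at h3
  exact le_of_tendsto h3.norm h1

/-- The coefficients of the expansion of `polylogReg s` at `0`. -/
noncomputable def polylogCoeff (k : ℕ) (s : ℂ) : ℂ :=
  (-1) ^ k * riemannZeta (s - k) / k.factorial

/-- The Taylor remainder of the regular part at `0`. -/
noncomputable def polylogRem (M : ℕ) (s : ℂ) (t : ℝ) : ℂ :=
  polylogReg s t - ∑ k ∈ Finset.range M, polylogCoeff k s * (t : ℂ) ^ k

theorem polylogCoeff_succ (k : ℕ) (s : ℂ) :
    polylogCoeff (k + 1) s * (k + 1) = -polylogCoeff k (s - 1) := by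
  rw [polylogCoeff, polylogCoeff, Nat.factorial_succ]
  have h1 : ((k : ℂ) + 1) ≠ 0 := by exact_mod_cast k.succ_ne_zero
  have h2 : (k.factorial : ℂ) ≠ 0 := by exact_mod_cast k.factorial_ne_zero
  have h3 : s - ((k + 1 : ℕ) : ℂ) = s - 1 - k := by push_cast; ring
  rw [h3]
  push_cast
  field_simp
  ring

/-- The coefficients satisfy the same recursion as the regular part, by `polylogCoeff_succ`, so the
remainder estimate can be obtained by induction on the order with $s$ shifted by one. -/
theorem hasDerivAt_polylogRem_succ (M : ℕ) {s : ℂ} (hs : s ≠ 1) {t : ℝ} (ht : 0 < t) :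
    HasDerivAt (polylogRem (M + 1) s) (-polylogRem M (s - 1) t) t := by
  have h1 : ∀ k : ℕ, HasDerivAt (fun x : ℝ => (x : ℂ) ^ k) (k * (t : ℂ) ^ (k - 1)) t := fun k => by
    simpa using (hasDerivAt_pow k (t : ℂ)).comp_ofReal
  refine ((hasDerivAt_polylogReg hs ht).sub (HasDerivAt.fun_sum fun k _ =>
    (h1 k).const_mul (polylogCoeff k s))).congr_deriv ?_
  rw [Finset.sum_range_succ', polylogRem]
  simp only [Nat.cast_zero, zero_mul, mul_zero, add_zero, Nat.add_sub_cancel, neg_sub]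
  rw [sub_eq_add_neg, neg_add_eq_sub, ← sub_eq_zero]
  have : ∑ x ∈ Finset.range M, polylogCoeff (x + 1) s * (((x + 1 : ℕ) : ℂ) * (t : ℂ) ^ x)
      = -∑ k ∈ Finset.range M, polylogCoeff k (s - 1) * (t : ℂ) ^ k := by
    rw [← Finset.sum_neg_distrib]
    refine Finset.sum_congr rfl fun k _ => ?_
    push_cast
    rw [← mul_assoc, polylogCoeff_succ, neg_mul]
  rw [this]
  ring

theorem tendsto_polylogRem_succ (M : ℕ) {s : ℂ} (hs : s.re < 1) :
    Tendsto (polylogRem (M + 1) s) (𝓝[>] 0) (𝓝 0) := by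
  have h1 : Tendsto (fun t : ℝ => ∑ k ∈ Finset.range (M + 1), polylogCoeff k s * (t : ℂ) ^ k)
      (𝓝[>] 0) (𝓝 (∑ k ∈ Finset.range (M + 1), polylogCoeff k s * ((0 : ℝ) : ℂ) ^ k)) :=
    (Continuous.tendsto (by fun_prop) 0).mono_left nhdsWithin_le_nhds
  have h2 := (tendsto_polylogReg hs).sub h1
  rw [Finset.sum_range_succ'] at h2
  simpa [polylogCoeff] using! h2

/-- The Taylor remainder is `O(t ^ M)` on all of `(0, ∞)`, locally uniformly in `s`. -/
theorem exists_norm_polylogRem_le (M : ℕ) {s₀ : ℂ} (hs₀ : s₀.re < 1) :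
    ∃ V ∈ 𝓝 s₀, ∃ C : ℝ, 0 ≤ C ∧ ∀ s ∈ V, ∀ t : ℝ, 0 < t → ‖polylogRem M s t‖ ≤ C * t ^ M := by
  induction M generalizing s₀ with
  | zero => simpa [polylogRem] using exists_norm_polylogReg_le hs₀
  | succ M ih =>
    obtain ⟨V, hV, C, hC, hb⟩ := ih (s₀ := s₀ - 1) (by simp; linarith)
    have hV' : (fun z => z - 1) ⁻¹' V ∈ 𝓝 s₀ := ContinuousAt.preimage_mem_nhds (by fun_prop) hV
    have hW : {z : ℂ | z.re < 1} ∈ 𝓝 s₀ :=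
      (isOpen_lt Complex.continuous_re continuous_const).mem_nhds hs₀
    refine ⟨_, inter_mem hV' hW, C, hC, fun s hs t ht => ?_⟩
    have hs1 : s ≠ 1 := by
      rintro rfl
      have := hs.2
      simp at this
    refine norm_le_of_hasDerivAt_of_tendsto_zero hC
      (fun x hx => hasDerivAt_polylogRem_succ M hs1 hx) (fun x hx => ?_)
      (tendsto_polylogRem_succ M hs.2) ht
    rw [norm_neg]
    exact hb _ hs.1 x hx

/-- Coefficients of the expansion of `polylogExp w` at `0`, singular term first. -/
noncomputable def expansionCoeff : ℕ → ℂ → ℂ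
  | 0, w => Complex.Gamma (1 - w)
  | k + 1, w => polylogCoeff k w

/-- Exponents of the expansion of `polylogExp w` at `0`, singular term first. -/
noncomputable def expansionExp : ℕ → ℂ → ℂ
  | 0, w => w - 1
  | k + 1, _ => k

/-- The truncated expansion of `polylogExp w` at `0`. -/
noncomputable def polylogApprox (M : ℕ) (w : ℂ) (t : ℝ) : ℂ :=
  ∑ i ∈ Finset.range (M + 1), expansionCoeff i w * (t : ℂ) ^ expansionExp i w

theorem polylogExp_eq_approx_add_rem (M : ℕ) (w : ℂ) (t : ℝ) :
    polylogExp w t = polylogApprox M w t + polylogRem M w t := by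
  rw [polylogApprox, Finset.sum_range_succ', polylogRem, polylogReg]
  simp only [expansionCoeff, expansionExp, Complex.cpow_natCast]
  ring

theorem continuousOn_polylogApprox (M : ℕ) (w : ℂ) : ContinuousOn (polylogApprox M w) (Ioi 0) :=
  continuousOn_finsetSum _ fun _ _ => continuousOn_const.mul fun _ ht =>
    (hasDerivAt_ofReal_cpow_const_of_pos _ ht).continuousAt.continuousWithinAt

theorem differentiable_expansionExp (i : ℕ) : Differentiable ℂ (expansionExp i) := by
  cases i with
  | zero => exact differentiable_id.sub_const 1
  | succ k => exact differentiable_const _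

theorem differentiableAt_polylogCoeff (k : ℕ) {w : ℂ} (hw : w.re < 1) :
    DifferentiableAt ℂ (polylogCoeff k) w := by
  have h1 : DifferentiableAt ℂ (fun w => riemannZeta (w - k)) w := by
    refine DifferentiableAt.comp (f := fun w : ℂ => w - k) (g := riemannZeta) w
      (differentiableAt_riemannZeta fun h => ?_) (by fun_prop)
    have := congrArg Complex.re h
    simp at this
    linarith [(Nat.cast_nonneg k : (0 : ℝ) ≤ k)]
  exact (h1.const_mul ((-1) ^ k)).div_const _

theorem differentiableAt_expansionCoeff (i : ℕ) {w : ℂ} (hw : w.re < 1) :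
    DifferentiableAt ℂ (expansionCoeff i) w := by
  cases i with
  | zero => exact differentiableAt_Gamma_one_sub hw
  | succ k => exact differentiableAt_polylogCoeff k hw

theorem differentiableAt_polylogApprox (M : ℕ) {w : ℂ} (hw : w.re < 1) {t : ℝ} (ht : 0 < t) :
    DifferentiableAt ℂ (fun w => polylogApprox M w t) w := by
  refine DifferentiableAt.fun_sum fun i _ => (differentiableAt_expansionCoeff i hw).mul ?_
  exact (differentiable_expansionExp i w).const_cpow (Or.inl (by exact_mod_cast ht.ne'))

theorem re_sub_one_le_re_expansionExp (i : ℕ) {w : ℂ} (hw : w.re < 1) :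
    w.re - 1 ≤ (expansionExp i w).re := by
  cases i with
  | zero => simp [expansionExp]
  | succ k =>
    simp only [expansionExp, Complex.natCast_re]
    linarith [(Nat.cast_nonneg k : (0 : ℝ) ≤ k)]

theorem norm_polylogApprox_le (M : ℕ) {w : ℂ} (hw : w.re < 1) {t : ℝ} (ht : 0 < t) (ht1 : t ≤ 1) :
    ‖polylogApprox M w t‖ ≤
      (∑ i ∈ Finset.range (M + 1), ‖expansionCoeff i w‖) * t ^ (w.re - 1) := by
  rw [Finset.sum_mul]
  refine norm_sum_le_of_le _ fun i _ => ?_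
  rw [norm_mul, Complex.norm_cpow_eq_rpow_re_of_pos ht]
  gcongr _ * ?_
  exact Real.rpow_le_rpow_of_exponent_ge ht ht1 (re_sub_one_le_re_expansionExp i hw)

/-! ### Continuation of the Mellin transform of the squared polylogarithm. -/

/-- In the difference of squares one factor is the remainder, $O(t^M)$, and the other is at worst
$O(t^{\operatorname{Re}w-1})$. The hypothesis on `M` says exactly that the resulting exponent
$\operatorname{Re}s+\operatorname{Re}w+M-2$ exceeds $-1$ at $s_0$. The order is a function `w` of
$s$ so that both $w(s)=s$ and $w=0$ are covered. -/
theorem exists_norm_cpow_mul_sq_sub_sq_le (M : ℕ) {w : ℂ → ℂ} (hw : Continuous w) {s₀ : ℂ}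
    (h1 : (w s₀).re < 1) (hM : 1 < s₀.re + (w s₀).re + M) :
    ∃ V ∈ 𝓝 s₀, ∃ C c : ℝ, -1 < c ∧ ∀ s ∈ V, ∀ t ∈ Ioc (0 : ℝ) 1,
      ‖(t : ℂ) ^ (s - 1) * (polylogExp (w s) t ^ 2 - polylogApprox M (w s) t ^ 2)‖ ≤ C * t ^ c := by
  obtain ⟨V, hV, C, hC, hb⟩ := exists_norm_polylogRem_le M h1
  have hV' : ∀ᶠ s in 𝓝 s₀, w s ∈ V := hw.continuousAt.preimage_mem_nhds hV
  set N : ℂ → ℝ := fun w => ∑ i ∈ Finset.range (M + 1), ‖expansionCoeff i w‖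
  have hNc : ContinuousAt (fun s => N (w s)) s₀ := by
    have : ContinuousAt N (w s₀) :=
      tendsto_finsetSum _ fun i _ => (differentiableAt_expansionCoeff i h1).continuousAt.norm
    exact ContinuousAt.comp (g := N) this hw.continuousAt
  have hN : ∀ᶠ s in 𝓝 s₀, N (w s) < N (w s₀) + 1 :=
    hNc.eventually_lt continuousAt_const (by simp)
  have hwre : ∀ᶠ s in 𝓝 s₀, (w s).re < 1 :=
    (Complex.continuous_re.comp hw).continuousAt.eventually_lt continuousAt_const h1
  -- The midpoint between $-1$ and the exponent at $s_0$: still integrable, with room for $s$ to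
  -- vary.
  set c : ℝ := ((s₀.re + (w s₀).re + M - 2) + (-1)) / 2 with hc
  have hexp : ∀ᶠ s in 𝓝 s₀, c < s.re + (w s).re + M - 2 :=
    continuousAt_const.eventually_lt (ContinuousAt.sub (ContinuousAt.add (ContinuousAt.add
      Complex.continuous_re.continuousAt (Complex.continuous_re.comp hw).continuousAt)
      continuousAt_const) continuousAt_const) (by rw [hc]; linarith)
  have hN0 : 0 ≤ N (w s₀) := Finset.sum_nonneg fun _ _ => norm_nonneg _
  refine ⟨_, hV'.and (hN.and (hwre.and hexp)), (2 * (N (w s₀) + 1) + C) * C, c, by linarith,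
    fun s hs t ht => ?_⟩
  obtain ⟨hs1, hs2, hs3, hs4⟩ := hs
  have ht0 : 0 < t := ht.1
  have e1 : polylogExp (w s) t ^ 2 - polylogApprox M (w s) t ^ 2 =
      (2 * polylogApprox M (w s) t + polylogRem M (w s) t) * polylogRem M (w s) t := by
    rw [polylogExp_eq_approx_add_rem M]; ring
  have hR := hb _ hs1 t ht0
  have hA := norm_polylogApprox_le M hs3 ht0 ht.2
  have hone : (1 : ℝ) ≤ t ^ ((w s).re - 1) :=
    Real.one_le_rpow_of_pos_of_le_one_of_nonpos ht0 ht.2 (by linarith)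
  have hR1 : ‖polylogRem M (w s) t‖ ≤ C * t ^ ((w s).re - 1) := by
    refine hR.trans ?_
    gcongr
    exact (pow_le_one₀ ht0.le ht.2).trans hone
  have hA1 : ‖polylogApprox M (w s) t‖ ≤ (N (w s₀) + 1) * t ^ ((w s).re - 1) :=
    hA.trans (by gcongr)
  have hsum : ‖2 * polylogApprox M (w s) t + polylogRem M (w s) t‖ ≤
      (2 * (N (w s₀) + 1) + C) * t ^ ((w s).re - 1) := by
    refine (norm_add_le _ _).trans ?_
    rw [norm_mul, Complex.norm_ofNat]
    linarith
  rw [e1, norm_mul, norm_mul, Complex.norm_cpow_eq_rpow_re_of_pos ht0, Complex.sub_re,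
    Complex.one_re]
  calc t ^ (s.re - 1) * (‖2 * polylogApprox M (w s) t + polylogRem M (w s) t‖ *
        ‖polylogRem M (w s) t‖)
      ≤ t ^ (s.re - 1) * ((2 * (N (w s₀) + 1) + C) * t ^ ((w s).re - 1) * (C * t ^ M)) := by
        gcongr
    _ = (2 * (N (w s₀) + 1) + C) * C * (t ^ (s.re - 1) * t ^ ((w s).re - 1) * t ^ (M : ℝ)) := by
        rw [Real.rpow_natCast]; ring
    _ = (2 * (N (w s₀) + 1) + C) * C * t ^ (s.re + (w s).re + M - 2) := by
        rw [← Real.rpow_add ht0, ← Real.rpow_add ht0]; congr 2; ring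
    _ ≤ _ := by
        gcongr _ * ?_
        exact Real.rpow_le_rpow_of_exponent_ge ht0 ht.2 hs4.le

theorem integrableOn_rpow_Ioc {c : ℝ} (hc : -1 < c) : IntegrableOn (fun t : ℝ => t ^ c) (Ioc 0 1) := by
  rw [← intervalIntegrable_iff_integrableOn_Ioc_of_le zero_le_one]
  exact intervalIntegral.intervalIntegrable_rpow' hc

theorem continuousOn_cpow_sub_one (s : ℂ) :
    ContinuousOn (fun t : ℝ => (t : ℂ) ^ (s - 1)) (Ioi 0) := fun _ ht =>
  (hasDerivAt_ofReal_cpow_const_of_pos _ ht).continuousAt.continuousWithinAt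

theorem aestronglyMeasurable_lowIntegrand (M : ℕ) (w s : ℂ) :
    AEStronglyMeasurable (fun t : ℝ => (t : ℂ) ^ (s - 1) *
      (polylogExp w t ^ 2 - polylogApprox M w t ^ 2)) (volume.restrict (Ioc 0 1)) := by
  refine ContinuousOn.aestronglyMeasurable (ContinuousOn.mono (s := Ioi 0) ?_ fun x hx => hx.1)
    measurableSet_Ioc
  exact (continuousOn_cpow_sub_one s).mul
    (((continuousOn_polylogExp w).pow 2).sub ((continuousOn_polylogApprox M w).pow 2))

theorem integrableOn_lowIntegrand (M : ℕ) {w s : ℂ} (h1 : w.re < 1) (hM : 1 < s.re + w.re + M) :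
    IntegrableOn (fun t : ℝ => (t : ℂ) ^ (s - 1) *
      (polylogExp w t ^ 2 - polylogApprox M w t ^ 2)) (Ioc 0 1) := by
  obtain ⟨V, hV, C, c, hc, hb⟩ := exists_norm_cpow_mul_sq_sub_sq_le M (w := fun _ => w)
    continuous_const (s₀ := s) h1 hM
  refine Integrable.mono' ((integrableOn_rpow_Ioc hc).const_mul C)
    (aestronglyMeasurable_lowIntegrand M w s) ?_
  filter_upwards [ae_restrict_mem measurableSet_Ioc] with t ht using hb s (mem_of_mem_nhds hV) t ht

/-- The part over `(0, 1]` of the Mellin transform of `polylogExp (w s) ^ 2`, with the truncated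
expansion removed. -/
noncomputable def lowIntegral (M : ℕ) (w : ℂ → ℂ) (s : ℂ) : ℂ :=
  ∫ t in Ioc (0 : ℝ) 1, (t : ℂ) ^ (s - 1) *
    (polylogExp (w s) t ^ 2 - polylogApprox M (w s) t ^ 2)

/-- The part over `(1, ∞)` of the Mellin transform of `polylogExp (w s) ^ 2`. -/
noncomputable def highIntegral (w : ℂ → ℂ) (s : ℂ) : ℂ :=
  ∫ t in Ioi (1 : ℝ), (t : ℂ) ^ (s - 1) * polylogExp (w s) t ^ 2

/-- The Mellin transform over `(0, 1]` of the square of the truncated expansion. -/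
noncomputable def polarPart (M : ℕ) (w : ℂ → ℂ) (s : ℂ) : ℂ :=
  ∑ i ∈ Finset.range (M + 1), ∑ j ∈ Finset.range (M + 1),
    expansionCoeff i (w s) * expansionCoeff j (w s) /
      (s + expansionExp i (w s) + expansionExp j (w s))

theorem isOpen_lowIntegral_domain (M : ℕ) {w : ℂ → ℂ} (hw : Continuous w) :
    IsOpen {s : ℂ | (w s).re < 1 ∧ 1 < s.re + (w s).re + M} := by
  refine IsOpen.inter ?_ ?_
  · exact isOpen_lt (Complex.continuous_re.comp hw) continuous_const
  · exact isOpen_lt continuous_const ((Complex.continuous_re.add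
      (Complex.continuous_re.comp hw)).add continuous_const)

theorem differentiableAt_cpow_sub_one {t : ℝ} (ht : 0 < t) (s : ℂ) :
    DifferentiableAt ℂ (fun s : ℂ => (t : ℂ) ^ (s - 1)) s :=
  (differentiableAt_id.sub_const _).const_cpow (Or.inl (by exact_mod_cast ht.ne'))

theorem differentiableOn_lowIntegral (M : ℕ) {w : ℂ → ℂ} (hw : Differentiable ℂ w) :
    DifferentiableOn ℂ (lowIntegral M w) {s | (w s).re < 1 ∧ 1 < s.re + (w s).re + M} := by
  refine differentiableOn_integral_of_locally_dominated
    (isOpen_lowIntegral_domain M hw.continuous)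
    (fun s _ => aestronglyMeasurable_lowIntegrand M (w s) s) ?_ fun s hs => ?_
  · filter_upwards [ae_restrict_mem measurableSet_Ioc] with t ht s hs
    refine DifferentiableAt.differentiableWithinAt ?_
    refine (differentiableAt_cpow_sub_one ht.1 s).mul (DifferentiableAt.sub ?_ ?_)
    · exact (DifferentiableAt.comp (g := fun w => polylogExp w t) s
        (differentiable_polylogExp ht.1 _) (hw s)).pow 2
    · exact (DifferentiableAt.comp (g := fun w => polylogApprox M w t) s
        (differentiableAt_polylogApprox M hs.1 ht.1) (hw s)).pow 2
  · obtain ⟨V, hV, C, c, hc, hb⟩ := exists_norm_cpow_mul_sq_sub_sq_le M hw.continuous hs.1 hs.2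
    refine ⟨V, hV, fun t => C * t ^ c, (integrableOn_rpow_Ioc hc).const_mul C, ?_⟩
    filter_upwards [ae_restrict_mem measurableSet_Ioc] with t ht z hz using hb z hz t ht

theorem exists_norm_highIntegrand_le {w : ℂ → ℂ} (hw : Continuous w) (s₀ : ℂ) :
    ∃ V ∈ 𝓝 s₀, ∃ C c : ℝ, 0 < c ∧ ∀ s ∈ V, ∀ t ∈ Ioi (1 : ℝ),
      ‖(t : ℂ) ^ (s - 1) * polylogExp (w s) t ^ 2‖ ≤ C * (t ^ c * Real.exp (-1 * t)) := by
  obtain ⟨m, hm⟩ := exists_nat_gt (-(w s₀).re)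
  obtain ⟨C, hC, hb⟩ := exists_norm_polylogExp_le m one_pos
  have h1 : ∀ᶠ s in 𝓝 s₀, -(m : ℝ) < (w s).re :=
    continuousAt_const.eventually_lt (Complex.continuous_re.comp hw).continuousAt
      (by linarith)
  have h2 : ∀ᶠ s : ℂ in 𝓝 s₀, s.re < |s₀.re| + 1 :=
    Complex.continuous_re.continuousAt.eventually_lt continuousAt_const
      (by linarith [le_abs_self s₀.re])
  refine ⟨_, h1.and h2, C ^ 2, |s₀.re| + 1, by positivity, fun s hs t ht => ?_⟩
  have ht1 : 1 < t := ht
  rw [norm_mul, norm_pow, Complex.norm_cpow_eq_rpow_re_of_pos (by linarith)]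
  have h3 : t ^ (s - 1).re ≤ t ^ (|s₀.re| + 1) :=
    Real.rpow_le_rpow_of_exponent_le ht1.le (by simp; linarith [hs.2])
  have h4 : ‖polylogExp (w s) t‖ ^ 2 ≤ C ^ 2 * Real.exp (-1 * t) := by
    calc ‖polylogExp (w s) t‖ ^ 2 ≤ (C * Real.exp (-t)) ^ 2 := by
          gcongr; exact hb _ hs.1.le t ht1.le
      _ = C ^ 2 * (Real.exp (-t) * Real.exp (-t)) := by ring
      _ ≤ C ^ 2 * (1 * Real.exp (-t)) := by
          gcongr
          rw [Real.exp_le_one_iff]; linarith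
      _ = _ := by simp
  calc _ ≤ t ^ (|s₀.re| + 1) * (C ^ 2 * Real.exp (-1 * t)) := by gcongr
    _ = _ := by ring

theorem integrableOn_rpow_mul_exp_neg_Ioi_one {c : ℝ} (hc : 0 < c) :
    IntegrableOn (fun t : ℝ => t ^ c * Real.exp (-1 * t)) (Ioi 1) := by
  have h := integrableOn_rpow_mul_exp_neg_mul_rpow (s := c) (p := 1) (b := 1) (by linarith)
    one_pos one_pos
  simp only [Real.rpow_one] at h
  exact h.mono_set (Ioi_subset_Ioi zero_le_one)

theorem aestronglyMeasurable_highIntegrand (w s : ℂ) :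
    AEStronglyMeasurable (fun t : ℝ => (t : ℂ) ^ (s - 1) * polylogExp w t ^ 2)
      (volume.restrict (Ioi 1)) := by
  refine ContinuousOn.aestronglyMeasurable (ContinuousOn.mono (s := Ioi 0) ?_
    (Ioi_subset_Ioi zero_le_one)) measurableSet_Ioi
  exact (continuousOn_cpow_sub_one s).mul ((continuousOn_polylogExp w).pow 2)

theorem integrableOn_highIntegrand (w s : ℂ) :
    IntegrableOn (fun t : ℝ => (t : ℂ) ^ (s - 1) * polylogExp w t ^ 2) (Ioi 1) := by
  obtain ⟨V, hV, C, c, hc, hb⟩ := exists_norm_highIntegrand_le (w := fun _ => w)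
    continuous_const s
  refine Integrable.mono' ((integrableOn_rpow_mul_exp_neg_Ioi_one hc).const_mul C)
    (aestronglyMeasurable_highIntegrand w s) ?_
  filter_upwards [ae_restrict_mem measurableSet_Ioi] with t ht using hb s (mem_of_mem_nhds hV) t ht

theorem differentiable_highIntegral {w : ℂ → ℂ} (hw : Differentiable ℂ w) :
    Differentiable ℂ (highIntegral w) := by
  rw [← differentiableOn_univ]
  refine differentiableOn_integral_of_locally_dominated isOpen_univ
    (fun s _ => aestronglyMeasurable_highIntegrand (w s) s) ?_ fun s hs => ?_
  · filter_upwards [ae_restrict_mem measurableSet_Ioi] with t ht s hs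
    have ht : 0 < t := zero_lt_one.trans ht
    refine DifferentiableAt.differentiableWithinAt ?_
    exact (differentiableAt_cpow_sub_one ht s).mul
      ((DifferentiableAt.comp (g := fun w => polylogExp w t) s
        (differentiable_polylogExp ht _) (hw s)).pow 2)
  · obtain ⟨V, hV, C, c, hc, hb⟩ := exists_norm_highIntegrand_le hw.continuous s
    refine ⟨V, hV, fun t => C * (t ^ c * Real.exp (-1 * t)),
      (integrableOn_rpow_mul_exp_neg_Ioi_one hc).const_mul C, ?_⟩
    filter_upwards [ae_restrict_mem measurableSet_Ioi] with t ht z hz using hb z hz t ht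

theorem integrableOn_cpow_Ioc {a : ℂ} (ha : 0 < a.re) :
    IntegrableOn (fun t : ℝ => (t : ℂ) ^ (a - 1)) (Ioc 0 1) := by
  rw [← intervalIntegrable_iff_integrableOn_Ioc_of_le zero_le_one]
  exact intervalIntegral.intervalIntegrable_cpow' (by simp; linarith)

theorem integral_cpow_Ioc {a : ℂ} (ha : 0 < a.re) :
    ∫ t in Ioc (0 : ℝ) 1, (t : ℂ) ^ (a - 1) = 1 / a := by
  rw [← intervalIntegral.integral_of_le zero_le_one, integral_cpow (Or.inl (by simp; linarith))]
  have : a ≠ 0 := by rintro rfl; simp at ha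
  simp [this]

/-- Decomposition of the Mellin transform of `polylogExp w ^ 2` in its half plane of
convergence. -/
theorem mellin_polylogExp_sq (M : ℕ) {w : ℂ → ℂ} {s : ℂ} (h1 : (w s).re < 1)
    (h2 : 2 < s.re + 2 * (w s).re) :
    mellin (fun t => polylogExp (w s) t ^ 2) s =
      highIntegral w s + polarPart M w s + lowIntegral M w s := by
  have hM0 : (0 : ℝ) ≤ M := M.cast_nonneg
  have hlow := integrableOn_lowIntegrand M (s := s) h1 (by linarith)
  have hterm : ∀ i j : ℕ, 0 < (s + expansionExp i (w s) + expansionExp j (w s)).re := fun i j => by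
    have hi := re_sub_one_le_re_expansionExp i h1
    have hj := re_sub_one_le_re_expansionExp j h1
    simp only [Complex.add_re]
    linarith
  have hsq : ∀ t ∈ Ioc (0 : ℝ) 1, (t : ℂ) ^ (s - 1) * polylogApprox M (w s) t ^ 2 =
      ∑ i ∈ Finset.range (M + 1), ∑ j ∈ Finset.range (M + 1),
        expansionCoeff i (w s) * expansionCoeff j (w s) *
          (t : ℂ) ^ (s + expansionExp i (w s) + expansionExp j (w s) - 1) := by
    intro t ht
    have ht0 : (t : ℂ) ≠ 0 := by exact_mod_cast ht.1.ne'
    rw [sq, polylogApprox, Finset.sum_mul_sum, Finset.mul_sum]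
    refine Finset.sum_congr rfl fun i _ => ?_
    rw [Finset.mul_sum]
    refine Finset.sum_congr rfl fun j _ => ?_
    have : s + expansionExp i (w s) + expansionExp j (w s) - 1 =
      (s - 1) + expansionExp i (w s) + expansionExp j (w s) := by ring
    rw [this, Complex.cpow_add _ _ ht0, Complex.cpow_add _ _ ht0]
    ring
  have hint : ∀ i j : ℕ, IntegrableOn (fun t : ℝ =>
      expansionCoeff i (w s) * expansionCoeff j (w s) *
          (t : ℂ) ^ (s + expansionExp i (w s) + expansionExp j (w s) - 1)) (Ioc 0 1) := fun i j =>
    (integrableOn_cpow_Ioc (hterm i j)).const_mul _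
  have happ : IntegrableOn (fun t : ℝ => (t : ℂ) ^ (s - 1) * polylogApprox M (w s) t ^ 2)
      (Ioc 0 1) := by
    refine IntegrableOn.congr_fun ?_ (fun t ht => (hsq t ht).symm) measurableSet_Ioc
    exact integrable_finsetSum _ fun i _ => integrable_finsetSum _ fun j _ => hint i j
  have hpol : ∫ t in Ioc (0 : ℝ) 1, (t : ℂ) ^ (s - 1) * polylogApprox M (w s) t ^ 2 =
      polarPart M w s := by
    rw [setIntegral_congr_fun measurableSet_Ioc hsq, integral_finsetSum _ fun i _ =>
      integrable_finsetSum _ fun j _ => hint i j, polarPart]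
    refine Finset.sum_congr rfl fun i _ => ?_
    rw [integral_finsetSum _ fun j _ => hint i j]
    refine Finset.sum_congr rfl fun j _ => ?_
    rw [integral_const_mul, integral_cpow_Ioc (hterm i j)]
    ring
  have hsplit : (fun t : ℝ => (t : ℂ) ^ (s - 1) * polylogExp (w s) t ^ 2) =
      fun t : ℝ => (t : ℂ) ^ (s - 1) * polylogApprox M (w s) t ^ 2 + (t : ℂ) ^ (s - 1) *
      (polylogExp (w s) t ^ 2 - polylogApprox M (w s) t ^ 2) := by
    ext t; ring
  have h01 : IntegrableOn (fun t : ℝ => (t : ℂ) ^ (s - 1) * polylogExp (w s) t ^ 2)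
      (Ioc 0 1) := by
    rw [hsplit]; exact happ.add hlow
  rw [mellin]
  simp only [smul_eq_mul]
  rw [← Ioc_union_Ioi_eq_Ioi zero_le_one, setIntegral_union
    (by rw [Set.disjoint_left]; exact fun x hx hx' => not_lt.2 hx.2 hx') measurableSet_Ioi h01
    (integrableOn_highIntegrand (w s) s)]
  have h3 : ∫ t in Ioc (0 : ℝ) 1, (t : ℂ) ^ (s - 1) * polylogExp (w s) t ^ 2 =
      polarPart M w s + lowIntegral M w s := by
    rw [hsplit, integral_add happ hlow, hpol, lowIntegral]
  rw [h3, highIntegral]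
  ring

/-! ### Mellin transforms of $\mathrm{Li}_w(e^{-t})$ and of $\mathrm{Li}_0(e^{-t})^2$. -/

theorem isBigO_polylogExp_atTop (w : ℂ) :
    polylogExp w =O[atTop] fun t => Real.exp (-1 * t) := by
  obtain ⟨m, hm⟩ := exists_nat_ge (-w.re)
  obtain ⟨C, hC, hb⟩ := exists_norm_polylogExp_le m one_pos
  refine IsBigO.of_bound C ?_
  filter_upwards [eventually_ge_atTop 1] with t ht
  rw [Real.norm_of_nonneg (Real.exp_pos _).le, neg_one_mul]
  exact hb w (by linarith) t ht

theorem isBigO_polylogExp_nhdsGT {w : ℂ} (hw : w.re < 1) :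
    polylogExp w =O[𝓝[>] 0] fun t : ℝ => t ^ (-(1 - w.re)) := by
  obtain ⟨V, hV, C, hC, hb⟩ := exists_norm_polylogReg_le hw
  refine IsBigO.of_bound (C + ‖Complex.Gamma (1 - w)‖) ?_
  filter_upwards [Ioo_mem_nhdsGT (zero_lt_one (α := ℝ))] with t ht
  have ht0 : 0 < t := ht.1
  have h1 : polylogExp w t = polylogReg w t + Complex.Gamma (1 - w) * (t : ℂ) ^ (w - 1) := by
    rw [polylogReg]; ring
  have hone : (1 : ℝ) ≤ t ^ (-(1 - w.re)) :=
    Real.one_le_rpow_of_pos_of_le_one_of_nonpos ht0 ht.2.le (by linarith)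
  rw [h1, Real.norm_of_nonneg (by positivity), add_mul]
  refine (norm_add_le _ _).trans (add_le_add ?_ ?_)
  · exact (hb w (mem_of_mem_nhds hV) t ht0).trans (le_mul_of_one_le_right hC hone)
  · rw [norm_mul, Complex.norm_cpow_eq_rpow_re_of_pos ht0]
    have : (w - 1).re = -(1 - w.re) := by simp
    rw [this]

theorem mellinConvergent_polylogExp {w s : ℂ} (hw : w.re < 1) (hs : 1 < s.re + w.re) :
    MellinConvergent (polylogExp w) s :=
  mellinConvergent_of_isBigO_rpow_exp one_pos
    ((continuousOn_polylogExp w).locallyIntegrableOn measurableSet_Ioi)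
    (isBigO_polylogExp_atTop w) (isBigO_polylogExp_nhdsGT hw) (by linarith)

theorem mellin_polylogExp {w s : ℂ} (hs : 0 < s.re) (hsw : 1 < s.re + w.re) :
    mellin (polylogExp w) s = Complex.Gamma s * riemannZeta (s + w) := by
  have hz := hasSum_riemannZeta_pnat (s := s + w) (by simpa using hsw)
  have heq : ∀ n : ℕ+, (n : ℂ) ^ (-(s + w)) = (n : ℂ) ^ (-w) / ((n : ℝ) : ℂ) ^ s := fun n => by
    have hn : (n : ℂ) ≠ 0 := by exact_mod_cast n.ne_zero
    rw [neg_add_rev, Complex.cpow_add _ _ hn, Complex.cpow_neg _ s, Complex.ofReal_natCast,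
      div_eq_mul_inv]
  have h := hasSum_mellin (ι := ℕ+) (s := s) (a := fun n => (n : ℂ) ^ (-w))
    (p := fun n => (n : ℝ)) (F := polylogExp w)
    (fun n => Or.inr (by exact_mod_cast n.pos)) hs (fun x hx => hasSum_polylogExp w hx) ?_
  · refine h.unique ?_
    convert! hz.mul_left (Complex.Gamma s) using 2 with n
    rw [heq, mul_div_assoc]
  · refine hz.summable.norm.congr fun n => ?_
    rw [heq, norm_div, Complex.norm_cpow_eq_rpow_re_of_pos (by exact_mod_cast n.pos)]

/-- The square of `1 / (e ^ t - 1)` in terms of its derivative. -/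
theorem polylogExp_zero_sq {t : ℝ} (ht : 0 < t) :
    polylogExp 0 t ^ 2 = polylogExp (-1) t - polylogExp 0 t := by
  have hne : Real.exp t - 1 ≠ 0 := by
    have := Real.add_one_lt_exp ht.ne'
    intro h; linarith
  have h1 : HasDerivAt (fun t => 1 / (Real.exp t - 1)) (-Real.exp t / (Real.exp t - 1) ^ 2) t := by
    simpa using! ((Real.hasDerivAt_exp t).sub_const 1).inv hne
  have h2 : polylogExp 0 =ᶠ[𝓝 t] fun t => ((1 / (Real.exp t - 1) : ℝ) : ℂ) := by
    filter_upwards [Ioi_mem_nhds ht] with x hx using polylogExp_zero hx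
  have h3 := (hasDerivAt_polylogExp 0 ht).unique (h1.ofReal_comp.congr_of_eventuallyEq h2)
  rw [zero_sub, neg_eq_iff_eq_neg] at h3
  rw [h3, polylogExp_zero ht, ← Complex.ofReal_neg, ← Complex.ofReal_sub, ← Complex.ofReal_pow]
  congr 1
  field_simp
  ring

/-- The identity $\mathrm{Li}_0^2=\mathrm{Li}_{-1}-\mathrm{Li}_0$ linearises the square. This is the
explicit comparison object for the transform with varying order. -/
theorem mellin_polylogExp_zero_sq {s : ℂ} (hs : 2 < s.re) :
    mellin (fun t => polylogExp 0 t ^ 2) s =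
      Complex.Gamma s * (riemannZeta (s - 1) - riemannZeta s) := by
  have h1 : mellin (fun t => polylogExp 0 t ^ 2) s =
      mellin (fun t => polylogExp (-1) t - polylogExp 0 t) s := by
    refine setIntegral_congr_fun measurableSet_Ioi fun t ht => ?_
    simp only [polylogExp_zero_sq ht]
  rw [h1, (hasMellin_sub (mellinConvergent_polylogExp (by simp) (by simp; linarith))
    (mellinConvergent_polylogExp (by simp) (by simp; linarith))).2,
    mellin_polylogExp (by linarith) (by simp; linarith),
    mellin_polylogExp (by linarith) (by simp; linarith), add_zero]
  ring_nf

/-! ### The Dirichlet series and its Mellin representation. -/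

/-- The Dirichlet series of the zeta function of `SU(3)`. -/
noncomputable def su3Series (s : ℂ) : ℂ :=
  ∑' p : ℕ+ × ℕ+, 1 / ((p.1 : ℂ) * (p.2 : ℂ) * ((p.1 : ℂ) + (p.2 : ℂ))) ^ s

/-- Since $j+k\ge\sqrt{jk}$, one has $jk(j+k)\ge(jk)^{3/2}$. The double series is thus dominated by
a product of two series, which converge when $\frac32c>1$. -/
theorem norm_su3_term_le (p : ℕ+ × ℕ+) {s : ℂ} {c : ℝ} (hc : 0 ≤ c) (hs : c ≤ s.re) :
    ‖1 / ((p.1 : ℂ) * (p.2 : ℂ) * ((p.1 : ℂ) + (p.2 : ℂ))) ^ s‖ ≤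
      (p.1 : ℝ) ^ (-(3 / 2 * c)) * (p.2 : ℝ) ^ (-(3 / 2 * c)) := by
  have h1 : (1 : ℝ) ≤ p.1 := by exact_mod_cast p.1.2
  have h2 : (1 : ℝ) ≤ p.2 := by exact_mod_cast p.2.2
  have h3 : ((p.1 : ℂ) * (p.2 : ℂ) * ((p.1 : ℂ) + (p.2 : ℂ))) =
      (((p.1 : ℝ) * p.2 * (p.1 + p.2) : ℝ) : ℂ) := by push_cast; rfl
  have h4 : (1 : ℝ) ≤ (p.1 : ℝ) * p.2 := by nlinarith
  rw [h3, norm_div, norm_one, Complex.norm_cpow_eq_rpow_re_of_pos (by positivity), one_div,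
    ← Real.mul_rpow (by positivity) (by positivity), Real.rpow_neg (by positivity)]
  gcongr
  have h5 : ((p.1 : ℝ) * p.2) ^ (3 / 2 : ℝ) ≤ (p.1 : ℝ) * p.2 * (p.1 + p.2) := by
    have h6 : (3 / 2 : ℝ) = 1 + 1 / 2 := by norm_num
    rw [h6, Real.rpow_add (by positivity), Real.rpow_one, ← Real.sqrt_eq_rpow]
    gcongr
    rw [Real.sqrt_le_left (by positivity)]
    nlinarith
  calc ((p.1 : ℝ) * p.2) ^ (3 / 2 * c) = (((p.1 : ℝ) * p.2) ^ (3 / 2 : ℝ)) ^ c := by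
        rw [Real.rpow_mul (by positivity)]
    _ ≤ ((p.1 : ℝ) * p.2 * (p.1 + p.2)) ^ c := by gcongr
    _ ≤ _ := Real.rpow_le_rpow_of_exponent_le (by nlinarith) hs

theorem summable_su3_bound {c : ℝ} (hc : 2 / 3 < c) :
    Summable fun p : ℕ+ × ℕ+ => (p.1 : ℝ) ^ (-(3 / 2 * c)) * (p.2 : ℝ) ^ (-(3 / 2 * c)) := by
  have h1 : Summable fun n : ℕ+ => (n : ℝ) ^ (-(3 / 2 * c)) :=
    (Real.summable_nat_rpow.2 (by linarith : -(3 / 2 * c) < -1)).comp_injective PNat.coe_injective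
  exact h1.mul_of_nonneg h1 (fun n => by positivity) (fun n => by positivity)

theorem hasSum_su3Series {s : ℂ} (hs : 2 / 3 < s.re) :
    HasSum (fun p : ℕ+ × ℕ+ => 1 / ((p.1 : ℂ) * (p.2 : ℂ) * ((p.1 : ℂ) + (p.2 : ℂ))) ^ s)
      (su3Series s) :=
  (Summable.of_norm_bounded (summable_su3_bound hs)
    fun p => norm_su3_term_le p (by linarith) le_rfl).hasSum

theorem isOpen_su3_halfPlane : IsOpen {s : ℂ | 2 / 3 < s.re} :=
  isOpen_lt continuous_const Complex.continuous_re

theorem differentiableOn_su3Series : DifferentiableOn ℂ su3Series {s | 2 / 3 < s.re} := by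
  intro s hs
  have hs : 2 / 3 < s.re := hs
  have hU : IsOpen {z : ℂ | (2 / 3 + s.re) / 2 < z.re} :=
    isOpen_lt continuous_const Complex.continuous_re
  refine ((Complex.differentiableOn_tsum_of_summable_norm
    (summable_su3_bound (c := (2 / 3 + s.re) / 2) (by linarith)) (fun p => ?_) hU
    (fun p z hz => norm_su3_term_le p (by linarith) (le_of_lt hz))).differentiableAt
    (hU.mem_nhds (by simp; linarith))).differentiableWithinAt
  have hne : ((p.1 : ℂ) * (p.2 : ℂ) * ((p.1 : ℂ) + (p.2 : ℂ))) ≠ 0 := by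
    have : (p.1 : ℕ) * p.2 * (p.1 + p.2) ≠ 0 := (p.1 * p.2 * (p.1 + p.2)).ne_zero
    exact_mod_cast this
  refine Differentiable.differentiableOn ?_
  intro z
  refine (differentiableAt_const _).div ((differentiableAt_id).const_cpow (Or.inl hne)) ?_
  simp [Complex.cpow_eq_zero_iff, hne]

/-- The Mellin representation of the Dirichlet series. -/
theorem mellin_polylogExp_sq_eq_su3Series {s : ℂ} (hs : 2 / 3 < s.re) :
    mellin (fun t => polylogExp s t ^ 2) s = Complex.Gamma s * su3Series s := by
  have heq : ∀ p : ℕ+ × ℕ+, 1 / ((p.1 : ℂ) * (p.2 : ℂ) * ((p.1 : ℂ) + (p.2 : ℂ))) ^ s =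
      ((p.1 : ℂ) ^ (-s) * (p.2 : ℂ) ^ (-s)) / (((p.1 : ℝ) + (p.2 : ℝ) : ℝ) : ℂ) ^ s := fun p => by
    have h1 : ((p.1 : ℂ) * (p.2 : ℂ) * ((p.1 : ℂ) + (p.2 : ℂ))) ^ s =
        (p.1 : ℂ) ^ s * (p.2 : ℂ) ^ s * ((p.1 : ℂ) + (p.2 : ℂ)) ^ s := by
      have h2 := Complex.natCast_mul_natCast_cpow (p.1 * p.2) (p.1 + p.2) s
      rw [Nat.cast_mul, Complex.natCast_mul_natCast_cpow] at h2
      exact_mod_cast h2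
    rw [h1, Complex.cpow_neg, Complex.cpow_neg]
    push_cast
    rw [← mul_inv, div_eq_mul_inv, div_eq_mul_inv, one_mul, ← mul_inv]
  have hD := hasSum_su3Series hs
  have h := hasSum_mellin (ι := ℕ+ × ℕ+) (s := s) (a := fun p => (p.1 : ℂ) ^ (-s) * (p.2 : ℂ) ^ (-s))
    (p := fun p => (p.1 : ℝ) + (p.2 : ℝ)) (F := fun t => polylogExp s t ^ 2)
    (fun p => Or.inr (by have := p.1.pos; positivity)) (by linarith) (fun t ht => ?_) ?_
  · refine h.unique ?_
    convert! hD.mul_left (Complex.Gamma s) using 2 with p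
    rw [heq, mul_div_assoc]
  · have h1 := hasSum_polylogExp s ht
    set f : ℕ+ → ℂ := fun n => (n : ℂ) ^ (-s) * (Real.exp (-(n : ℝ) * t) : ℂ) with hf
    have h2 : Summable fun p : ℕ+ × ℕ+ => f p.1 * f p.2 :=
      summable_mul_of_summable_norm h1.summable.norm h1.summable.norm
    have h3 : HasSum (fun p : ℕ+ × ℕ+ => f p.1 * f p.2) (polylogExp s t * polylogExp s t) :=
      HasSum.mul h1 h1 h2
    rw [sq]
    refine h3.congr_fun fun p => ?_
    simp only [hf]
    have : Real.exp (-((p.1 : ℝ) + (p.2 : ℝ)) * t) =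
        Real.exp (-(p.1 : ℝ) * t) * Real.exp (-(p.2 : ℝ) * t) := by
      rw [← Real.exp_add]; congr 1; ring
    rw [this]
    push_cast
    ring
  · refine hD.summable.norm.congr fun p => ?_
    rw [heq, norm_div, Complex.norm_cpow_eq_rpow_re_of_pos (by have := p.1.pos; positivity)]

/-! ### Uniqueness and existence of the continuation. -/

theorem IsSU3Zeta.eq {ω₁ ω₂ : ℂ → ℂ} (h₁ : IsSU3Zeta ω₁) (h₂ : IsSU3Zeta ω₂) : ω₁ = ω₂ := by
  have hloc : ω₁ =ᶠ[𝓝[≠] (1 : ℂ)] ω₂ := by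
    have : {s : ℂ | 2 / 3 < s.re} ∈ 𝓝 (1 : ℂ) :=
      isOpen_su3_halfPlane.mem_nhds (by simp; norm_num)
    filter_upwards [mem_nhdsWithin_of_mem_nhds this] with s hs
      using (h₁.hasSum s hs).unique (h₂.hasSum s hs)
  ext z
  have h := h₁.meromorphic.meromorphicOn.eventuallyEq_nhdsNE_of_isPreconnected
    h₂.meromorphic.meromorphicOn isPreconnected_univ (mem_univ _) (mem_univ z) hloc
  exact (((h₁.meromorphic (mem_univ z)).eventuallyEq_nhdsNE_iff_eventuallyEq_nhds
    (h₂.meromorphic (mem_univ z))).1 h).eq_of_nhds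

theorem meromorphicAt_polarPart (M : ℕ) {w : ℂ → ℂ} (hw : Differentiable ℂ w) {s : ℂ}
    (hs : (w s).re < 1) : MeromorphicAt (polarPart M w) s := by
  have hU : IsOpen {w : ℂ | w.re < 1} := isOpen_lt Complex.continuous_re continuous_const
  have hc : ∀ i, MeromorphicAt (fun s => expansionCoeff i (w s)) s := fun i => by
    have h1 : AnalyticAt ℂ (expansionCoeff i) (w s) :=
      DifferentiableOn.analyticAt (s := {w : ℂ | w.re < 1})
        (fun z hz => (differentiableAt_expansionCoeff i hz).differentiableWithinAt)
        (hU.mem_nhds hs)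
    exact (h1.comp (hw.analyticAt s)).meromorphicAt
  have he : ∀ i, MeromorphicAt (fun s => expansionExp i (w s)) s := fun i =>
    (((differentiable_expansionExp i).comp hw).analyticAt s).meromorphicAt
  refine MeromorphicAt.fun_sum fun i _ => MeromorphicAt.fun_sum fun j _ => ?_
  exact ((hc i).mul (hc j)).div (((MeromorphicAt.id s).add (he i)).add (he j))

/-- The continuation of the Mellin transform of `polylogExp (w s) ^ 2`. -/
noncomputable def polylogSqCont (M : ℕ) (w : ℂ → ℂ) (s : ℂ) : ℂ :=
  highIntegral w s + polarPart M w s + lowIntegral M w s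

theorem meromorphicAt_polylogSqCont (M : ℕ) {w : ℂ → ℂ} (hw : Differentiable ℂ w) {s : ℂ}
    (hs : (w s).re < 1) (hM : 1 < s.re + (w s).re + M) :
    MeromorphicAt (polylogSqCont M w) s := by
  have h1 : AnalyticAt ℂ (lowIntegral M w) s := (differentiableOn_lowIntegral M hw).analyticAt
    ((isOpen_lowIntegral_domain M hw.continuous).mem_nhds ⟨hs, hM⟩)
  exact (((differentiable_highIntegral hw).analyticAt s).meromorphicAt.add
    (meromorphicAt_polarPart M hw hs)).add h1.meromorphicAt

/-- The continuation of `su3Series` to a strip. -/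
noncomputable def su3Cont (M : ℕ) (s : ℂ) : ℂ :=
  polylogSqCont M (fun s => s) s / Complex.Gamma s

theorem meromorphicAt_su3Cont (M : ℕ) {s : ℂ} (hs : s.re < 1) (hM : 1 < s.re + s.re + M) :
    MeromorphicAt (su3Cont M) s :=
  (meromorphicAt_polylogSqCont M differentiable_fun_id hs hM).div
    (MeromorphicNFOn.Gamma (mem_univ s)).meromorphicAt

theorem su3Series_eq_su3Cont (M : ℕ) {s : ℂ} (hs : 2 / 3 < s.re) (hs1 : s.re < 1) :
    su3Series s = su3Cont M s := by
  have h1 := mellin_polylogExp_sq M (w := fun s => s) (s := s) hs1 (by linarith)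
  have h2 := mellin_polylogExp_sq_eq_su3Series hs
  rw [su3Cont, polylogSqCont, ← h1, h2,
    mul_div_cancel_left₀ _ (Complex.Gamma_ne_zero_of_re_pos (by linarith))]

/-- On each half plane $\operatorname{Re}s>-n$ the series and a strip continuation are joined, then
put in normal form. Normal forms that agree near $1$ agree at every common point, so the pieces glue
to a global function. -/
theorem exists_isSU3Zeta : ∃ ω : ℂ → ℂ, IsSU3Zeta ω := by
  classical
  let U : ℕ → Set ℂ := fun n => {s | -(n : ℝ) < s.re}
  have hUo : ∀ n, IsOpen (U n) := fun n => isOpen_lt continuous_const Complex.continuous_re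
  have hUc : ∀ n, Convex ℝ (U n) := fun n => convex_halfSpace_re_gt _
  -- With truncation order $M=2n+1$ the condition $1<2\operatorname{Re}s+M$ becomes
  -- $\operatorname{Re}s>-n$.
  let f : ℕ → ℂ → ℂ := fun n s => if 2 / 3 < s.re then su3Series s else su3Cont (2 * n + 1) s
  have hright : ∀ n s, 2 / 3 < s.re → f n =ᶠ[𝓝 s] su3Series := fun n s hs => by
    filter_upwards [isOpen_su3_halfPlane.mem_nhds hs] with z hz using if_pos hz
  have hana : ∀ s : ℂ, 2 / 3 < s.re → AnalyticAt ℂ su3Series s := fun s hs =>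
    differentiableOn_su3Series.analyticAt (isOpen_su3_halfPlane.mem_nhds hs)
  have hleft : ∀ n s, s.re < 1 → f n =ᶠ[𝓝 s] su3Cont (2 * n + 1) := fun n s hs => by
    filter_upwards [(isOpen_lt Complex.continuous_re continuous_const).mem_nhds hs] with z hz
    by_cases hz' : 2 / 3 < z.re
    · simp only [f, if_pos hz']
      exact su3Series_eq_su3Cont _ hz' hz
    · simp only [f, if_neg hz']
  have hf : ∀ n, MeromorphicOn (f n) (U n) := fun n s hs => by
    have hs : -(n : ℝ) < s.re := hs
    rcases lt_or_ge s.re 1 with h1 | h1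
    · refine (meromorphicAt_su3Cont (2 * n + 1) h1 ?_).congr
        ((hleft n s h1).symm.filter_mono nhdsWithin_le_nhds)
      push_cast
      linarith
    · exact ((hana s (by linarith)).congr (hright n s (by linarith)).symm).meromorphicAt
  let φ : ℕ → ℂ → ℂ := fun n => toMeromorphicNFOn (f n) (U n)
  have hφ : ∀ n, MeromorphicNFOn (φ n) (U n) := fun n => meromorphicNFOn_toMeromorphicNFOn _ _
  have hφr : ∀ n s, 2 / 3 < s.re → φ n =ᶠ[𝓝 s] su3Series := fun n s hs => by
    have hsU : s ∈ U n := by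
      have : (0 : ℝ) ≤ n := n.cast_nonneg
      simp only [U, mem_ofPred_eq]
      linarith
    refine ((hφ n hsU).eventuallyEq_nhdsNE_iff_eventuallyEq_nhds (hana s hs).meromorphicNFAt).1 ?_
    exact ((hf n).toMeromorphicNFOn_eq_self_on_nhdsNE hsU).trans
      ((hright n s hs).filter_mono nhdsWithin_le_nhds)
  have hagree : ∀ m n s, s ∈ U m → s ∈ U n → φ m s = φ n s := fun m n s hm hn => by
    have h1 : (1 : ℂ) ∈ U m ∩ U n := by
      constructor
      · have : (0 : ℝ) ≤ m := m.cast_nonneg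
        simp only [U, mem_ofPred_eq, Complex.one_re]; linarith
      · have : (0 : ℝ) ≤ n := n.cast_nonneg
        simp only [U, mem_ofPred_eq, Complex.one_re]; linarith
    have h2 : φ m =ᶠ[𝓝[≠] (1 : ℂ)] φ n := by
      have h3 : 2 / 3 < (1 : ℂ).re := by simp; norm_num
      exact ((hφr m 1 h3).trans (hφr n 1 h3).symm).filter_mono nhdsWithin_le_nhds
    have h4 := MeromorphicOn.eventuallyEq_nhdsNE_of_isPreconnected (U := U m ∩ U n)
      (fun z hz => ((hφ m) hz.1).meromorphicAt) (fun z hz => ((hφ n) hz.2).meromorphicAt)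
      ((hUc m).inter (hUc n)).isPreconnected h1 ⟨hm, hn⟩ h2
    exact (((hφ m hm).eventuallyEq_nhdsNE_iff_eventuallyEq_nhds (hφ n hn)).1 h4).eq_of_nhds
  let N : ℂ → ℕ := fun s => ⌈-s.re⌉₊ + 1
  have hN : ∀ s, s ∈ U (N s) := fun s => by
    have := Nat.le_ceil (-s.re)
    simp only [U, N, mem_ofPred_eq]
    push_cast
    linarith
  refine ⟨fun s => φ (N s) s, ?_, fun s hs => ?_⟩
  · intro s _
    refine (meromorphicNFAt_congr ?_).2 (hφ (N s) (hN s))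
    filter_upwards [(hUo (N s)).mem_nhds (hN s)] with z hz using hagree _ _ z (hN z) hz
  · rw [(hφr (N s) s hs).eq_of_nhds]
    exact hasSum_su3Series hs

/-! ### The derivative at $0$. -/

/-- Truncation order $2$ gives a continuation on $-\frac12<\operatorname{Re}s<1$, a strip containing
$0$ that overlaps the half plane of convergence; $5/6$ is a point of the overlap. -/
theorem IsSU3Zeta.eventuallyEq_su3Cont {ω : ℂ → ℂ} (hω : IsSU3Zeta ω) :
    ω =ᶠ[𝓝[≠] 0] su3Cont 2 := by
  have hU : Convex ℝ ({s : ℂ | s.re < 1} ∩ {s : ℂ | -1 / 2 < s.re}) :=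
    (convex_halfSpace_re_lt 1).inter (convex_halfSpace_re_gt _)
  have hmer : MeromorphicOn (su3Cont 2) ({s : ℂ | s.re < 1} ∩ {s : ℂ | -1 / 2 < s.re}) :=
    fun s hs => by
      have h1 : s.re < 1 := hs.1
      have h2 : -1 / 2 < s.re := hs.2
      exact meromorphicAt_su3Cont 2 h1 (by push_cast; linarith)
  refine MeromorphicOn.eventuallyEq_nhdsNE_of_isPreconnected
    (fun s _ => (hω.meromorphic (mem_univ s)).meromorphicAt) hmer hU.isPreconnected
    (x := (((5 / 6 : ℝ)) : ℂ)) ?_ ?_ ?_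
  · constructor <;> simp only [mem_ofPred_eq, Complex.ofReal_re] <;> norm_num
  · constructor <;> simp only [mem_ofPred_eq, Complex.zero_re] <;> norm_num
  · have h : {s : ℂ | s.re < 1} ∩ {s : ℂ | 2 / 3 < s.re} ∈ 𝓝 (((5 / 6 : ℝ)) : ℂ) := by
      refine ((isOpen_lt Complex.continuous_re continuous_const).inter
        isOpen_su3_halfPlane).mem_nhds ?_
      constructor <;> simp only [mem_ofPred_eq, Complex.ofReal_re] <;> norm_num
    filter_upwards [mem_nhdsWithin_of_mem_nhds h] with s hs
    rw [← su3Series_eq_su3Cont 2 hs.2 hs.1]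
    exact (hω.hasSum s hs.2).unique (hasSum_su3Series hs.2)

theorem polylogSqCont_zero_eventuallyEq :
    polylogSqCont 2 (fun _ => 0) =ᶠ[𝓝[≠] 0]
      fun s => Complex.Gamma s * (riemannZeta (s - 1) - riemannZeta s) := by
  have hmer : MeromorphicOn (polylogSqCont 2 (fun _ => 0)) {s : ℂ | -1 < s.re} := fun s hs => by
    have h1 : -1 < s.re := hs
    exact meromorphicAt_polylogSqCont 2 (differentiable_const _) (by simp)
      (by simp; linarith)
  refine hmer.eventuallyEq_nhdsNE_of_isPreconnected (fun s _ => ?_)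
    (convex_halfSpace_re_gt (-1)).isPreconnected (x := 3) (by simp; norm_num) (by simp) ?_
  · have h1 : MeromorphicAt (fun s => riemannZeta (s - 1)) s :=
      MeromorphicAt.comp_analyticAt (f := riemannZeta) (g := fun s => s - 1)
        (meromorphicAt_riemannZeta _) (by fun_prop)
    exact (MeromorphicNFOn.Gamma (mem_univ s)).meromorphicAt.mul
      (h1.sub (meromorphicAt_riemannZeta s))
  · have h : {s : ℂ | 2 < s.re} ∈ 𝓝 (3 : ℂ) :=
      (isOpen_lt continuous_const Complex.continuous_re).mem_nhds (by simp; norm_num)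
    filter_upwards [mem_nhdsWithin_of_mem_nhds h] with s hs
    have hs : 2 < s.re := hs
    rw [← mellin_polylogExp_zero_sq hs]
    exact (mellin_polylogExp_sq 2 (w := fun _ => 0) (s := s) (by simp) (by simpa using hs)).symm

/-- `polylogSqCont 2 w` without the terms singular at `0`. -/
noncomputable def polylogSqContReg (w : ℂ → ℂ) (s : ℂ) : ℂ :=
  highIntegral w s + lowIntegral 2 w s +
    (Complex.Gamma (1 - w s) ^ 2 / (s + 2 * w s - 2) +
      2 * Complex.Gamma (1 - w s) * riemannZeta (w s) / (s + w s - 1) -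
      2 * riemannZeta (w s) * riemannZeta (w s - 1) / (s + 1) +
      riemannZeta (w s - 1) ^ 2 / (s + 2))

/-- When $w(0)=0$, only two kinds of products in the squared expansion produce a pole at $s=0$: the
constant term with itself, giving $1/s$, and the singular power $t^{w-1}$ with the linear term,
giving $1/(s+w)$ twice. -/
theorem polylogSqCont_eq_reg_add (w : ℂ → ℂ) (s : ℂ) :
    polylogSqCont 2 w s = polylogSqContReg w s + (riemannZeta (w s) ^ 2 / s -
      2 * Complex.Gamma (1 - w s) * riemannZeta (w s - 1) / (s + w s)) := by
  rw [polylogSqCont, polylogSqContReg, polarPart]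
  simp only [Finset.sum_range_succ, Finset.sum_range_zero, expansionCoeff, expansionExp,
    polylogCoeff]
  have e1 : s + (w s - 1) + (w s - 1) = s + 2 * w s - 2 := by ring
  have e2 : s + (w s - 1) + (0 : ℕ) = s + w s - 1 := by push_cast; ring
  have e3 : s + (w s - 1) + (1 : ℕ) = s + w s := by push_cast; ring
  have e4 : s + (0 : ℕ) + (w s - 1) = s + w s - 1 := by push_cast; ring
  have e5 : s + (1 : ℕ) + (w s - 1) = s + w s := by push_cast; ring
  have e6 : s + (0 : ℕ) + (0 : ℕ) = s := by push_cast; ring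
  have e7 : s + (0 : ℕ) + (1 : ℕ) = s + 1 := by push_cast; ring
  have e8 : s + (1 : ℕ) + (0 : ℕ) = s + 1 := by push_cast; ring
  have e9 : s + (1 : ℕ) + (1 : ℕ) = s + 2 := by push_cast; ring
  rw [e1, e2, e3, e4, e5, e6, e7, e8, e9]
  simp only [Nat.cast_zero, Nat.cast_one, sub_zero, Nat.factorial_zero, Nat.factorial_one, pow_zero,
    pow_one, div_one, one_mul]
  ring

theorem differentiableAt_polylogSqContReg {w : ℂ → ℂ} (hw : Differentiable ℂ w) (h0 : w 0 = 0) :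
    DifferentiableAt ℂ (polylogSqContReg w) 0 := by
  have hw0 : (w 0).re < 1 := by rw [h0]; simp
  have hl : DifferentiableAt ℂ (lowIntegral 2 w) 0 :=
    (differentiableOn_lowIntegral 2 hw).differentiableAt
      ((isOpen_lowIntegral_domain 2 hw.continuous).mem_nhds ⟨hw0, by simp [h0]⟩)
  have hG : DifferentiableAt ℂ (fun s => Complex.Gamma (1 - w s)) 0 :=
    DifferentiableAt.comp (g := fun w => Complex.Gamma (1 - w)) 0
      (differentiableAt_Gamma_one_sub hw0) (hw 0)
  have hz : DifferentiableAt ℂ (fun s => riemannZeta (w s)) 0 :=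
    DifferentiableAt.comp (g := riemannZeta) 0
      (differentiableAt_riemannZeta (by rw [h0]; exact zero_ne_one)) (hw 0)
  have hz1 : DifferentiableAt ℂ (fun s => riemannZeta (w s - 1)) 0 :=
    DifferentiableAt.comp (g := riemannZeta) (f := fun s => w s - 1) 0
      (differentiableAt_riemannZeta (by rw [h0]; norm_num)) ((hw 0).sub_const 1)
  have hw' := hw 0
  refine ((differentiable_highIntegral hw 0).add hl).add (DifferentiableAt.add
    (DifferentiableAt.sub (DifferentiableAt.add ?_ ?_) ?_) ?_)
  · exact (hG.pow 2).div (by fun_prop) (by simp [h0])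
  · exact ((hG.const_mul 2).mul hz).div (by fun_prop) (by simp [h0])
  · exact ((hz.const_mul 2).mul hz1).div (by fun_prop) (by simp)
  · exact (hz1.pow 2).div (by fun_prop) (by simp)

/-- The derivative of the `SU(3)` zeta function at `0` is `log (2 π)`. -/
theorem IsSU3Zeta.hasDerivAt_zero {ω : ℂ → ℂ} (hω : IsSU3Zeta ω) :
    HasDerivAt ω (Real.log (2 * Real.pi) : ℂ) 0 := by
  -- The two orders $w(s)=s$ and $w=0$ agree at $s=0$, so the unevaluated regular parts cancel
  -- there.
  let D : ℂ → ℂ := fun s => polylogSqContReg (fun s => s) s - polylogSqContReg (fun _ => 0) s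
  have hD : DifferentiableAt ℂ D 0 :=
    (differentiableAt_polylogSqContReg differentiable_fun_id rfl).sub
      (differentiableAt_polylogSqContReg (differentiable_const _) rfl)
  have hD0 : D 0 = 0 := sub_eq_zero.2 rfl
  -- This is $\omega$ near $0$, after adding and subtracting the case $w=0$ and using
  -- $1/\Gamma(s)=s/\Gamma(s+1)$ to clear the poles. In `s * D s` the derivative of `D` does not
  -- contribute at $0$.
  let g : ℂ → ℂ := fun s => (Complex.Gamma (s + 1))⁻¹ * (s * D s + (riemannZeta s ^ 2 -
    riemannZeta 0 ^ 2) - Complex.Gamma (1 - s) * riemannZeta (s - 1) + 2 * riemannZeta (-1)) +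
    riemannZeta (s - 1) - riemannZeta s
  have hG1 : HasDerivAt Complex.Gamma (deriv Complex.Gamma 1) 1 := by
    refine (Complex.differentiableAt_Gamma _ fun m hm => ?_).hasDerivAt
    have := congrArg Complex.re hm
    simp at this
    linarith [(Nat.cast_nonneg m : (0 : ℝ) ≤ m)]
  have hGa : HasDerivAt (fun s => Complex.Gamma (s + 1)) (deriv Complex.Gamma 1) 0 :=
    HasDerivAt.comp_add_const (f := Complex.Gamma) 0 1 (by simpa using hG1)
  have hGb : HasDerivAt (fun s => Complex.Gamma (1 - s)) (-deriv Complex.Gamma 1) 0 :=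
    HasDerivAt.comp_const_sub (f := Complex.Gamma) 1 0 (by simpa using hG1)
  have hz0 : HasDerivAt riemannZeta (deriv riemannZeta 0) 0 :=
    (differentiableAt_riemannZeta zero_ne_one).hasDerivAt
  have hz1 : HasDerivAt (fun s => riemannZeta (s - 1)) (deriv riemannZeta (-1)) 0 :=
    HasDerivAt.comp_sub_const (f := riemannZeta) 0 1 (by
      rw [zero_sub]
      exact (differentiableAt_riemannZeta (by norm_num)).hasDerivAt)
  have hg : HasDerivAt g (Real.log (2 * Real.pi) : ℂ) 0 := by
    have h := (((hGa.inv (by simp)).mul (((((hasDerivAt_id (0 : ℂ)).mul hD.hasDerivAt).add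
      ((hz0.pow 2).sub_const (riemannZeta 0 ^ 2))).sub (hGb.mul hz1)).add_const
      (2 * riemannZeta (-1)))).add hz1).sub hz0
    refine h.congr_deriv ?_
    have hlog : Complex.log (2 * Real.pi) = (Real.log (2 * Real.pi) : ℂ) := by
      rw [Complex.ofReal_log (by positivity)]; push_cast; rfl
    simp only [Pi.add_apply, Pi.sub_apply, Pi.mul_apply, Pi.pow_apply, Pi.inv_apply, hD0,
      riemannZeta_zero, deriv_riemannZeta_zero, hlog, id_eq, sub_zero, zero_add, zero_sub,
      Complex.Gamma_one]
    push_cast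
    ring
  have hne : ω =ᶠ[𝓝[≠] 0] g := by
    have hre : {s : ℂ | -1 < s.re} ∈ 𝓝 (0 : ℂ) :=
      (isOpen_lt continuous_const Complex.continuous_re).mem_nhds (by simp)
    filter_upwards [hω.eventuallyEq_su3Cont, polylogSqCont_zero_eventuallyEq, self_mem_nhdsWithin,
      mem_nhdsWithin_of_mem_nhds hre] with s h1 h2 hs hs1
    have hs0 : s ≠ 0 := hs
    have hs1 : -1 < s.re := hs1
    have hΓ : Complex.Gamma (s + 1) ≠ 0 :=
      Complex.Gamma_ne_zero_of_re_pos (by simp; linarith)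
    have hΓs : Complex.Gamma s = Complex.Gamma (s + 1) / s := by
      rw [Complex.Gamma_add_one _ hs0]; field_simp
    rw [h1, su3Cont, polylogSqCont_eq_reg_add]
    rw [polylogSqCont_eq_reg_add, hΓs] at h2
    simp only [sub_zero, Complex.Gamma_one, zero_sub, add_zero] at h2
    simp only [g, D]
    have h3 : polylogSqContReg (fun _ => 0) s = Complex.Gamma (s + 1) / s *
        (riemannZeta (s - 1) - riemannZeta s) - (riemannZeta 0 ^ 2 / s -
        2 * 1 * riemannZeta (-1) / s) := by rw [← h2]; ring
    rw [h3, hΓs]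
    field_simp
    ring
  have hNF := hω.meromorphic (mem_univ (0 : ℂ))
  -- A finite limit excludes a pole, and normal form then makes $\omega$ analytic at $0$, so
  -- agreement off $0$ extends to $0$ itself.
  have hlim : Tendsto ω (𝓝[≠] 0) (𝓝 (g 0)) :=
    (hg.continuousAt.tendsto.mono_left nhdsWithin_le_nhds).congr' hne.symm
  have hcont : ContinuousAt ω 0 := (hNF.meromorphicOrderAt_nonneg_iff_analyticAt.1
    ((tendsto_nhds_iff_meromorphicOrderAt_nonneg hNF.meromorphicAt).1 ⟨_, hlim⟩)).continuousAt
  have heq : ω =ᶠ[𝓝 0] g :=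
    (hcont.eventuallyEq_nhds_iff_eventuallyEq_nhdsNE hg.continuousAt).1 hne
  exact hg.congr_of_eventuallyEq heq

/-! ### The Mellin transform of the remainder, Parseval and the integral. -/

/-- Integration by parts for Mellin transforms. -/
theorem mellin_hasDerivAt {f f' : ℝ → ℂ} {s : ℂ} {a b : ℝ}
    (hf : ∀ x, 0 < x → HasDerivAt f (f' x) x) (htop : f =O[atTop] (· ^ (-a))) (ha : s.re < a)
    (hbot : f =O[𝓝[>] 0] (· ^ (-b))) (hb : b < s.re) (hf' : MellinConvergent f' (s + 1)) :
    mellin f' (s + 1) = -(s * mellin f s) := by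
  have hfc : ContinuousOn f (Ioi 0) := fun x hx => (hf x hx).continuousAt.continuousWithinAt
  have hconv : MellinConvergent f s := mellinConvergent_of_isBigO_rpow
    (hfc.locallyIntegrableOn measurableSet_Ioi) htop ha hbot hb
  have hpow : ∀ l : Filter ℝ, (∀ᶠ x in l, 0 < x) →
      (fun x : ℝ => (x : ℂ) ^ s) =O[l] fun x : ℝ => x ^ s.re := fun l hl => by
    refine IsBigO.of_bound 1 ?_
    filter_upwards [hl] with x hx
    rw [Complex.norm_cpow_eq_rpow_re_of_pos hx, Real.norm_of_nonneg (by positivity), one_mul]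
  have h0 : Tendsto ((fun x : ℝ => (x : ℂ) ^ s) * f) (𝓝[>] 0) (𝓝 0) := by
    refine ((hpow _ self_mem_nhdsWithin).mul hbot).trans_tendsto ?_
    have h1 : Tendsto (fun x : ℝ => x ^ (s.re - b)) (𝓝[>] 0) (𝓝 0) := by
      have := (Real.continuousAt_rpow_const 0 (s.re - b) (Or.inr (by linarith))).tendsto
      rw [Real.zero_rpow (by linarith)] at this
      exact this.mono_left nhdsWithin_le_nhds
    refine h1.congr' ?_
    filter_upwards [self_mem_nhdsWithin] with x hx
    rw [← Real.rpow_add hx, sub_eq_add_neg]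
  have hinf : Tendsto ((fun x : ℝ => (x : ℂ) ^ s) * f) atTop (𝓝 0) := by
    refine ((hpow _ (eventually_gt_atTop 0)).mul htop).trans_tendsto ?_
    have h1 : Tendsto (fun x : ℝ => x ^ (-(a - s.re))) atTop (𝓝 0) :=
      tendsto_rpow_neg_atTop (by linarith)
    refine h1.congr' ?_
    filter_upwards [eventually_gt_atTop 0] with x hx
    rw [← Real.rpow_add hx]
    congr 1
    ring
  have key := integral_Ioi_mul_deriv_eq_deriv_mul (u := fun x : ℝ => (x : ℂ) ^ s)
    (u' := fun x : ℝ => s * (x : ℂ) ^ (s - 1)) (v := f) (v' := f')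
    (fun x hx => hasDerivAt_ofReal_cpow_const_of_pos s hx) (fun x hx => hf x hx) ?_ ?_ h0 hinf
  · simp only [mellin, smul_eq_mul, add_sub_cancel_right]
    rw [key, sub_zero, zero_sub, ← integral_const_mul]
    simp only [mul_assoc]
  · simpa [MellinConvergent] using! hf'
  · have h := hconv.const_smul s
    refine h.congr (ae_of_all _ fun x => ?_)
    simp only [smul_eq_mul, Pi.mul_apply]
    ring

/-- Let $t\to0^+$ in `hasMellin_polylogReg_add`. The bound by $C/(1+x)^{M+1}$ holds uniformly in
$t\ge0$ and gives dominated convergence, and the right-hand side tends to $\Gamma(s+M)\zeta(s)$. -/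
theorem hasMellin_polylogReg_neg_nat {s : ℂ} {M : ℕ} (hs : -(M : ℝ) < s.re) (hs1 : s.re < 1) :
    HasMellin (polylogReg (-(M : ℂ))) (s + M) (Complex.Gamma (s + M) * riemannZeta s) := by
  obtain ⟨C, hC, hb⟩ := exists_norm_polylogReg_neg_nat_le M
  have hsM : 0 < (s + M).re := by simp; linarith
  have hsM1 : (s + M).re < M + 1 := by simp; linarith
  have hbd : IntegrableOn (fun x : ℝ => C * (x ^ ((s + M).re - 1) / (1 + x) ^ (M + 1))) (Ioi 0) :=
    (integrableOn_rpow_div_one_add_pow hsM hsM1).const_mul C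
  have hnorm : ∀ t : ℝ, 0 ≤ t → ∀ᵐ x : ℝ ∂(volume.restrict (Ioi (0 : ℝ))),
      ‖(x : ℂ) ^ (s + M - 1) • polylogReg (-(M : ℂ)) (x + t)‖ ≤
        C * (x ^ ((s + M).re - 1) / (1 + x) ^ (M + 1)) := fun t ht => by
    filter_upwards [ae_restrict_mem measurableSet_Ioi] with x hx
    rw [norm_smul, Complex.norm_cpow_eq_rpow_re_of_pos hx, mul_div_left_comm, Complex.sub_re,
      Complex.one_re]
    exact mul_le_mul_of_nonneg_left (norm_polylogReg_neg_nat_add_le hC hb hx ht)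
      (Real.rpow_nonneg (le_of_lt hx) _)
  have hconv : MellinConvergent (polylogReg (-(M : ℂ))) (s + M) := by
    refine Integrable.mono' hbd ?_ (by simpa using hnorm 0 le_rfl)
    exact ((continuousOn_cpow_sub_one _).smul (continuousOn_polylogReg _)).aestronglyMeasurable
      measurableSet_Ioi
  refine ⟨hconv, ?_⟩
  have h1 : Tendsto (fun t : ℝ => mellin (fun x => polylogReg (-(M : ℂ)) (x + t)) (s + M))
      (𝓝[>] 0) (𝓝 (mellin (polylogReg (-(M : ℂ))) (s + M))) := by
    refine tendsto_integral_filter_of_dominated_convergence _ ?_ ?_ hbd ?_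
    · filter_upwards [self_mem_nhdsWithin] with t ht
      exact (hasMellin_polylogReg_add hs hs1 ht).1.1
    · filter_upwards [self_mem_nhdsWithin] with t ht using hnorm t (le_of_lt ht)
    · filter_upwards [ae_restrict_mem measurableSet_Ioi] with x hx
      have h2 : ContinuousAt (polylogReg (-(M : ℂ))) (x + 0) := by
        rw [add_zero]
        exact (continuousOn_polylogReg _).continuousAt (Ioi_mem_nhds hx)
      have h3 : ContinuousAt (fun t => polylogReg (-(M : ℂ)) (x + t)) 0 :=
        ContinuousAt.comp (f := fun t => x + t) h2 (by fun_prop)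
      have h4 := h3.tendsto.mono_left (nhdsWithin_le_nhds (s := Ioi 0))
      simp only [add_zero] at h4
      exact h4.const_smul _
  refine tendsto_nhds_unique h1 ?_
  refine ((tendsto_polylogReg hs1).const_mul (Complex.Gamma (s + M))).congr' ?_
  filter_upwards [self_mem_nhdsWithin] with t ht
  exact (hasMellin_polylogReg_add hs hs1 ht).2.symm

theorem isBigO_rpow_of_forall_pos {f : ℝ → ℂ} {C a : ℝ} {l : Filter ℝ}
    (hl : ∀ᶠ x in l, (0 : ℝ) < x) (h : ∀ x, 0 < x → ‖f x‖ ≤ C * x ^ a) :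
    f =O[l] fun x : ℝ => x ^ a := by
  refine IsBigO.of_bound C ?_
  filter_upwards [hl] with x hx
  rw [Real.norm_of_nonneg (by positivity)]
  exact h x hx

theorem hasDerivAt_polylogRem_two_zero {x : ℝ} (hx : 0 < x) :
    HasDerivAt (polylogRem 2 0) (-polylogRem 1 (-1) x) x := by
  simpa using hasDerivAt_polylogRem_succ 1 (s := 0) zero_ne_one hx

theorem hasDerivAt_polylogRem_one_neg_one {x : ℝ} (hx : 0 < x) :
    HasDerivAt (polylogRem 1 (-1)) (-polylogReg (-2) x) x := by
  have h := hasDerivAt_polylogRem_succ 0 (s := -1) (by norm_num) hx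
  have h2 : polylogRem 0 (-1 - 1) x = polylogReg (-2) x := by
    norm_num [polylogRem]
  rwa [h2] at h

theorem exists_norm_polylogRem_one_neg_one_le :
    ∃ C : ℝ, 0 ≤ C ∧ ∀ x : ℝ, 0 < x →
      ‖polylogRem 1 (-1) x‖ ≤ C * x ^ (0 : ℝ) ∧ ‖polylogRem 1 (-1) x‖ ≤ C * x ^ (1 : ℝ) := by
  obtain ⟨V, hV, C, hC, hb⟩ := exists_norm_polylogRem_le 1 (s₀ := -1) (by simp)
  obtain ⟨W, hW, B, hB, hb'⟩ := exists_norm_polylogReg_le (s₀ := -1) (by simp)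
  refine ⟨max C (B + ‖polylogCoeff 0 (-1)‖), le_max_of_le_left hC, fun x hx => ⟨?_, ?_⟩⟩
  · rw [Real.rpow_zero, mul_one]
    refine le_max_of_le_right ?_
    have h1 : polylogRem 1 (-1) x = polylogReg (-1) x - polylogCoeff 0 (-1) := by
      simp [polylogRem]
    rw [h1]
    refine (norm_sub_le _ _).trans ?_
    gcongr
    exact hb' _ (mem_of_mem_nhds hW) x hx
  · rw [Real.rpow_one]
    refine (hb _ (mem_of_mem_nhds hV) x hx).trans ?_
    rw [pow_one]
    gcongr
    exact le_max_left _ _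

/-- The quadratic bound governs $x\to0$ and the linear one $x\to\infty$; together they give the
Mellin strip $-2<\operatorname{Re}s<-1$. -/
theorem exists_norm_polylogRem_two_zero_le :
    ∃ C : ℝ, 0 ≤ C ∧ ∀ x : ℝ, 0 < x →
      ‖polylogRem 2 0 x‖ ≤ C * x ^ (1 : ℝ) ∧ ‖polylogRem 2 0 x‖ ≤ C * x ^ (2 : ℝ) := by
  obtain ⟨C, hC, hb⟩ := exists_norm_polylogRem_one_neg_one_le
  have h0 : Tendsto (polylogRem 2 0) (𝓝[>] 0) (𝓝 0) := tendsto_polylogRem_succ 1 (by simp)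
  refine ⟨C, hC, fun x hx => ⟨?_, ?_⟩⟩
  · have h := norm_le_of_hasDerivAt_of_tendsto_zero hC (k := 0)
      (fun x hx => hasDerivAt_polylogRem_two_zero hx)
      (fun x hx => by rw [norm_neg]; simpa using (hb x hx).1) h0 hx
    simpa using h
  · have h := norm_le_of_hasDerivAt_of_tendsto_zero hC (k := 1)
      (fun x hx => hasDerivAt_polylogRem_two_zero hx)
      (fun x hx => by rw [norm_neg]; simpa using (hb x hx).2) h0 hx
    exact_mod_cast h

theorem continuousOn_polylogRem_two_zero : ContinuousOn (polylogRem 2 0) (Ioi 0) :=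
  fun _ hx => (hasDerivAt_polylogRem_two_zero hx).continuousAt.continuousWithinAt

theorem mellinConvergent_polylogRem_two_zero {s : ℂ} (h1 : -2 < s.re) (h2 : s.re < -1) :
    MellinConvergent (polylogRem 2 0) s := by
  obtain ⟨C, hC, hb⟩ := exists_norm_polylogRem_two_zero_le
  exact mellinConvergent_of_isBigO_rpow (a := -1) (b := -2)
    (continuousOn_polylogRem_two_zero.locallyIntegrableOn measurableSet_Ioi)
    (isBigO_rpow_of_forall_pos (eventually_gt_atTop 0) fun x hx => by
      rw [neg_neg]; exact (hb x hx).1) h2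
    (isBigO_rpow_of_forall_pos self_mem_nhdsWithin fun x hx => by
      rw [neg_neg]; exact (hb x hx).2) h1

theorem mellin_polylogReg_neg_two {s : ℂ} (h1 : -2 < s.re) (h2 : s.re < 1) :
    HasMellin (polylogReg (-2)) (s + 2) (Complex.Gamma (s + 2) * riemannZeta s) := by
  simpa using hasMellin_polylogReg_neg_nat (M := 2) (by simpa using h1) h2

/-- Two integrations by parts; the two-sided power bounds make every boundary term vanish in this
strip. -/
theorem mellin_polylogRem_two_zero {s : ℂ} (h1 : -2 < s.re) (h2 : s.re < -1) :
    s * (s + 1) * mellin (polylogRem 2 0) s = mellin (polylogReg (-2)) (s + 2) := by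
  obtain ⟨C, hC, hb⟩ := exists_norm_polylogRem_two_zero_le
  obtain ⟨C', hC', hb'⟩ := exists_norm_polylogRem_one_neg_one_le
  have hc : ContinuousOn (polylogRem 1 (-1)) (Ioi 0) :=
    fun _ hx => (hasDerivAt_polylogRem_one_neg_one hx).continuousAt.continuousWithinAt
  have t0 : polylogRem 2 0 =O[atTop] fun x : ℝ => x ^ (-(-1) : ℝ) :=
    isBigO_rpow_of_forall_pos (eventually_gt_atTop 0) fun x hx => by
      rw [neg_neg]; exact (hb x hx).1
  have b0 : polylogRem 2 0 =O[𝓝[>] 0] fun x : ℝ => x ^ (-(-2) : ℝ) :=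
    isBigO_rpow_of_forall_pos self_mem_nhdsWithin fun x hx => by
      rw [neg_neg]; exact (hb x hx).2
  have t1 : polylogRem 1 (-1) =O[atTop] fun x : ℝ => x ^ (-0 : ℝ) :=
    isBigO_rpow_of_forall_pos (eventually_gt_atTop 0) fun x hx => by
      rw [neg_zero]; exact (hb' x hx).1
  have b1 : polylogRem 1 (-1) =O[𝓝[>] 0] fun x : ℝ => x ^ (-(-1) : ℝ) :=
    isBigO_rpow_of_forall_pos self_mem_nhdsWithin fun x hx => by
      rw [neg_neg]; exact (hb' x hx).2
  have c1 : MellinConvergent (polylogRem 1 (-1)) (s + 1) :=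
    mellinConvergent_of_isBigO_rpow (hc.locallyIntegrableOn measurableSet_Ioi) t1
      (by simp; linarith) b1 (by simp; linarith)
  have hs2 : s + 1 + 1 = s + 2 := by ring
  have c2 : MellinConvergent (polylogReg (-2)) (s + 1 + 1) := by
    rw [hs2]; exact (mellin_polylogReg_neg_two h1 (by linarith)).1
  have hneg : ∀ f : ℝ → ℂ, ∀ z : ℂ, mellin (fun x => -f x) z = -mellin f z := fun f z => by
    simpa using mellin_const_smul f z (-1 : ℂ)
  have e1 := mellin_hasDerivAt (fun x hx => hasDerivAt_polylogRem_two_zero hx) t0 h2 b0 h1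
    (by simpa using c1.const_smul (-1 : ℂ))
  have e2 := mellin_hasDerivAt (s := s + 1) (fun x hx => hasDerivAt_polylogRem_one_neg_one hx) t1
    (by simp; linarith) b1 (by simp; linarith) (by simpa using c2.const_smul (-1 : ℂ))
  rw [hneg, neg_inj] at e1 e2
  rw [← hs2, e2, e1]
  ring

theorem mellin_polylogRem_two_zero_eq {s : ℂ} (h1 : -2 < s.re) (h2 : s.re < -1) :
    mellin (polylogRem 2 0) s = Complex.Gamma s * riemannZeta s := by
  have hs0 : s ≠ 0 := by rintro rfl; simp at h2; linarith
  have hs1 : s + 1 ≠ 0 := fun h => by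
    have := congrArg Complex.re h
    simp at this
    linarith
  have h := mellin_polylogRem_two_zero h1 h2
  rw [(mellin_polylogReg_neg_two h1 (by linarith)).2] at h
  have h3 : Complex.Gamma (s + 2) = (s + 1) * (s * Complex.Gamma s) := by
    rw [← Complex.Gamma_add_one s hs0, ← Complex.Gamma_add_one _ hs1]
    congr 1; ring
  rw [h3] at h
  refine mul_left_cancel₀ (mul_ne_zero hs0 hs1) (h.trans ?_)
  ring

theorem differentiableAt_Gamma_mul_zeta {s : ℂ} (h : s.re = -(3 / 2)) :
    DifferentiableAt ℂ (fun s => Complex.Gamma s * riemannZeta s) s := by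
  refine (Complex.differentiableAt_Gamma s fun m hm => ?_).mul
    (differentiableAt_riemannZeta fun h1 => ?_)
  · have := congrArg Complex.re hm
    rw [h] at this
    simp only [Complex.neg_re, Complex.natCast_re, neg_inj] at this
    have h2 : ((3 : ℕ) : ℝ) = ((2 * m : ℕ) : ℝ) := by push_cast; linarith
    have h3 : 3 = 2 * m := by exact_mod_cast h2
    omega
  · rw [h1] at h
    norm_num at h

/-- On the line, $s(s+1)$ times the transform is itself a Mellin transform bounded independently of
the height. This gives decay $O(1/(1+y^2))$, enough for Mellin inversion, with no growth estimate
for $\zeta$. -/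
theorem verticalIntegrable_mellin_polylogRem :
    Integrable fun y : ℝ => mellin (polylogRem 2 0) (((-(3 / 2) : ℝ) : ℂ) + y * Complex.I) := by
  set z : ℝ → ℂ := fun y => ((-(3 / 2) : ℝ) : ℂ) + y * Complex.I with hz
  have hre : ∀ y, (z y).re = -(3 / 2) := fun y => by simp [hz]
  have him : ∀ y, (z y).im = y := fun y => by simp [hz]
  obtain ⟨C, hC, hb⟩ := exists_norm_polylogReg_neg_nat_le 2
  set B : ℝ := ∫ x in Ioi (0 : ℝ), C * (x ^ ((1 / 2 : ℝ) - 1) / (1 + x) ^ (2 + 1)) with hB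
  have hBb : ∀ y, ‖mellin (polylogReg (-2)) (z y + 2)‖ ≤ B := fun y => by
    refine norm_integral_le_of_norm_le
      ((integrableOn_rpow_div_one_add_pow (by norm_num) (by norm_num)).const_mul C) ?_
    filter_upwards [ae_restrict_mem measurableSet_Ioi] with x hx
    have hx : 0 < x := hx
    rw [norm_smul, Complex.norm_cpow_eq_rpow_re_of_pos hx, mul_div_left_comm]
    have h1 : (z y + 2 - 1).re = 1 / 2 - 1 := by
      simp only [Complex.sub_re, Complex.add_re, hre, Complex.re_ofNat, Complex.one_re]; norm_num
    have h2 := hb x hx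
    rw [Nat.cast_ofNat] at h2
    rw [h1]
    gcongr
  have hB0 : 0 ≤ B := (norm_nonneg _).trans (hBb 0)
  refine Integrable.mono' (g := fun y : ℝ => 2 * B * (1 + y ^ 2)⁻¹)
    (integrable_inv_one_add_sq.const_mul (2 * B)) ?_ (ae_of_all _ fun y => ?_)
  · have h1 : (fun y => mellin (polylogRem 2 0) (z y)) =
        fun y => Complex.Gamma (z y) * riemannZeta (z y) := by
      ext y
      exact mellin_polylogRem_two_zero_eq (by rw [hre]; norm_num) (by rw [hre]; norm_num)
    rw [h1]
    refine Continuous.aestronglyMeasurable (continuous_iff_continuousAt.2 fun y => ?_)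
    exact ContinuousAt.comp (f := z) (g := fun s => Complex.Gamma s * riemannZeta s)
      (differentiableAt_Gamma_mul_zeta (hre y)).continuousAt (by fun_prop)
  · have h1 := mellin_polylogRem_two_zero (s := z y) (by rw [hre]; norm_num)
      (by rw [hre]; norm_num)
    have h2 := hBb y
    rw [← h1, norm_mul] at h2
    have h3 : (1 + y ^ 2) / 2 ≤ ‖z y * (z y + 1)‖ := by
      refine abs_le_of_sq_le_sq' ?_ (norm_nonneg _) |>.2
      rw [norm_mul, mul_pow, ← Complex.normSq_eq_norm_sq, ← Complex.normSq_eq_norm_sq,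
        Complex.normSq_apply, Complex.normSq_apply, Complex.add_re (z y) 1, Complex.add_im (z y) 1,
        hre, him, Complex.one_re, Complex.one_im]
      nlinarith [sq_nonneg y, sq_nonneg (y ^ 2)]
    rw [← div_eq_mul_inv, le_div_iff₀ (by positivity)]
    have h4 : (1 + y ^ 2) / 2 * ‖mellin (polylogRem 2 0) (z y)‖ ≤ B :=
      (mul_le_mul_of_nonneg_right h3 (norm_nonneg _)).trans h2
    linarith

theorem mellinInv_mellin_polylogRem {x : ℝ} (hx : 0 < x) :
    polylogRem 2 0 x = 1 / (2 * Real.pi) * ∫ y : ℝ,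
      (x : ℂ) ^ (-(((-(3 / 2) : ℝ) : ℂ) + y * Complex.I)) *
        mellin (polylogRem 2 0) (((-(3 / 2) : ℝ) : ℂ) + y * Complex.I) := by
  have h := mellinInv_mellin_eq (-(3 / 2)) (polylogRem 2 0) hx
    (mellinConvergent_polylogRem_two_zero (by norm_num) (by norm_num))
    verticalIntegrable_mellin_polylogRem (hasDerivAt_polylogRem_two_zero hx).continuousAt
  rw [← h, mellinInv, Complex.real_smul]
  simp

/-- Parseval's formula for the product of `polylogExp 0` and its Taylor remainder. -/
theorem mellin_parseval_polylogRem :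
    Integrable (fun y : ℝ => mellin (polylogExp 0) ((3 / 2 : ℝ) - y * Complex.I) *
      mellin (polylogRem 2 0) (((-(3 / 2) : ℝ) : ℂ) + y * Complex.I)) ∧
    mellin (fun x => polylogExp 0 x * polylogRem 2 0 x) 0 =
      1 / (2 * Real.pi) * ∫ y : ℝ, mellin (polylogExp 0) ((3 / 2 : ℝ) - y * Complex.I) *
        mellin (polylogRem 2 0) (((-(3 / 2) : ℝ) : ℂ) + y * Complex.I) := by
  set A : ℝ → ℂ := fun y => mellin (polylogRem 2 0) (((-(3 / 2) : ℝ) : ℂ) + y * Complex.I) with hA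
  have hAi : Integrable A := verticalIntegrable_mellin_polylogRem
  let μ : Measure ℝ := volume.restrict (Ioi 0)
  let G : ℝ → ℂ := fun x => (x : ℂ) ^ (((3 / 2 : ℝ) : ℂ) - 1) * polylogExp 0 x
  have hG : Integrable G μ := by
    have := mellinConvergent_polylogExp (w := 0) (s := ((3 / 2 : ℝ) : ℂ)) (by simp)
      (by rw [Complex.ofReal_re]; norm_num)
    simpa [MellinConvergent, G, μ] using! this
  -- The kernel $x^{-iy}$ is unimodular, so absolute integrability reduces to that of the product
  -- $G(x)A(y)$. Integrating in $y$ first uses Mellin inversion; integrating in $x$ first gives the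
  -- transform on $\operatorname{Re}=3/2$.
  let F : ℝ → ℝ → ℂ := fun x y => (x : ℂ) ^ (-(y * Complex.I)) * (G x * A y)
  have hF : Integrable (Function.uncurry F) (μ.prod volume) := by
    have h1 : Integrable (fun p : ℝ × ℝ => G p.1 * A p.2) (μ.prod volume) := hG.mul_prod hAi
    refine Integrable.mono h1 (AEStronglyMeasurable.mul ?_ h1.1) ?_
    · have : μ.prod volume = (volume.prod volume).restrict (Ioi (0 : ℝ) ×ˢ (univ : Set ℝ)) := by
        rw [← Measure.prod_restrict, Measure.restrict_univ]
      rw [this]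
      refine ContinuousOn.aestronglyMeasurable (fun p hp => ContinuousAt.continuousWithinAt ?_)
        (measurableSet_Ioi.prod MeasurableSet.univ)
      have hp0 : 0 < p.1 := hp.1
      refine ContinuousAt.cpow (by fun_prop) (by fun_prop) ?_
      exact Complex.ofReal_mem_slitPlane.2 hp0
    · have h0 : ∀ᵐ p ∂(μ.prod (volume : Measure ℝ)), p.1 ∈ Ioi (0 : ℝ) :=
        Measure.quasiMeasurePreserving_fst.ae (ae_restrict_mem measurableSet_Ioi)
      filter_upwards [h0] with p hp
      have hp : 0 < p.1 := hp
      simp only [Function.uncurry, F]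
      rw [norm_mul, Complex.norm_cpow_eq_rpow_re_of_pos hp]
      simp
  have hin1 : ∀ x ∈ Ioi (0 : ℝ), 1 / (2 * Real.pi) * ∫ y, F x y =
      (x : ℂ) ^ ((0 : ℂ) - 1) • (polylogExp 0 x * polylogRem 2 0 x) := by
    intro x hx
    have hx : 0 < x := hx
    have hx0 : (x : ℂ) ≠ 0 := by exact_mod_cast hx.ne'
    rw [mellinInv_mellin_polylogRem hx, smul_eq_mul]
    have h1 : ∀ y : ℝ, F x y = ((x : ℂ) ^ ((0 : ℂ) - 1) * polylogExp 0 x) *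
        ((x : ℂ) ^ (-(((-(3 / 2) : ℝ) : ℂ) + y * Complex.I)) * A y) := fun y => by
      have h2 : (x : ℂ) ^ (-(y * Complex.I)) * (x : ℂ) ^ (((3 / 2 : ℝ) : ℂ) - 1) =
          (x : ℂ) ^ ((0 : ℂ) - 1) * (x : ℂ) ^ (-(((-(3 / 2) : ℝ) : ℂ) + y * Complex.I)) := by
        rw [← Complex.cpow_add _ _ hx0, ← Complex.cpow_add _ _ hx0]
        congr 1; push_cast; ring
      simp only [F, G]
      linear_combination (polylogExp 0 x * A y) * h2
    simp only [h1, integral_const_mul]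
    ring
  have hin2 : ∀ y : ℝ, ∫ x, F x y ∂μ =
      mellin (polylogExp 0) ((3 / 2 : ℝ) - y * Complex.I) * A y := by
    intro y
    rw [mellin, ← integral_mul_const]
    refine setIntegral_congr_fun measurableSet_Ioi fun x hx => ?_
    have hx0 : (x : ℂ) ≠ 0 := by exact_mod_cast (ne_of_gt hx)
    have h2 : (x : ℂ) ^ (((3 / 2 : ℝ) : ℂ) - y * Complex.I - 1) =
        (x : ℂ) ^ (-(y * Complex.I)) * (x : ℂ) ^ (((3 / 2 : ℝ) : ℂ) - 1) := by
      rw [← Complex.cpow_add _ _ hx0]; congr 1; ring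
    simp only [F, G, smul_eq_mul, h2]
    ring
  constructor
  · have := hF.integral_prod_right
    simpa only [Function.uncurry, hin2] using this
  · rw [mellin, ← setIntegral_congr_fun measurableSet_Ioi hin1, integral_const_mul]
    congr 1
    change ∫ x, ∫ y, F x y ∂volume ∂μ = _
    rw [integral_integral_swap hF]
    simp only [hin2, hA]

/-- The reflection formula at $z=\frac32+it$, where $\sin\pi z=-\cosh\pi t$, gives
$\Gamma(z)\Gamma(-z)=\pi/(z\cosh\pi t)$. The Parseval variable is $-t$. -/
theorem su3Integrand_eq (t : ℝ) :
    su3Integrand t = 1 / Real.pi * (mellin (polylogExp 0) ((3 / 2 : ℝ) - (-t : ℝ) * Complex.I) *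
      mellin (polylogRem 2 0) (((-(3 / 2) : ℝ) : ℂ) + (-t : ℝ) * Complex.I)) := by
  set z : ℂ := 3 / 2 + Complex.I * t with hz
  have hzre : z.re = 3 / 2 := by simp [hz]
  have e1 : (((3 / 2 : ℝ) : ℂ) - (-t : ℝ) * Complex.I) = z := by rw [hz]; push_cast; ring
  have e2 : (((-(3 / 2) : ℝ) : ℂ) + (-t : ℝ) * Complex.I) = -z := by rw [hz]; push_cast; ring
  have e3 : (-3 / 2 - Complex.I * t : ℂ) = -z := by rw [hz]; ring
  have hz0 : z ≠ 0 := by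
    intro h; rw [h] at hzre; norm_num at hzre
  rw [su3Integrand, e1, e2, e3, ← hz, mellin_polylogExp (by rw [hzre]; norm_num)
    (by rw [hzre]; norm_num), add_zero, mellin_polylogRem_two_zero_eq
    (by rw [Complex.neg_re, hzre]; norm_num) (by rw [Complex.neg_re, hzre]; norm_num)]
  have hsin : Complex.sin (Real.pi * z) = -(Real.cosh (Real.pi * t) : ℂ) := by
    have h1 : (Real.pi : ℂ) * z = (Real.pi * t * Complex.I + Real.pi / 2) + Real.pi := by
      rw [hz]; ring
    rw [h1, Complex.sin_add_pi, Complex.sin_add_pi_div_two, Complex.cos_mul_I]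
    push_cast
    rfl
  have hrefl := Complex.Gamma_mul_Gamma_one_sub z
  have hG : Complex.Gamma (1 - z) = -z * Complex.Gamma (-z) := by
    rw [← Complex.Gamma_add_one _ (neg_ne_zero.2 hz0)]; congr 1; ring
  rw [hG, hsin] at hrefl
  have hc : (Real.cosh (Real.pi * t) : ℂ) ≠ 0 := by
    exact_mod_cast (Real.cosh_pos _).ne'
  have hpi : (Real.pi : ℂ) ≠ 0 := by exact_mod_cast Real.pi_ne_zero
  have hGG : Complex.Gamma z * Complex.Gamma (-z) =
      Real.pi / (z * (Real.cosh (Real.pi * t) : ℂ)) := by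
    rw [eq_div_iff (mul_ne_zero hz0 hc)]
    rw [eq_div_iff (neg_ne_zero.2 hc)] at hrefl
    linear_combination hrefl
  have : 1 / (Real.pi : ℂ) * (Complex.Gamma z * riemannZeta z * (Complex.Gamma (-z) *
      riemannZeta (-z))) = 1 / (Real.pi : ℂ) * (Complex.Gamma z * Complex.Gamma (-z)) *
      (riemannZeta z * riemannZeta (-z)) := by ring
  rw [this, hGG]
  field_simp

theorem integrable_su3Integrand : Integrable su3Integrand := by
  have h := (mellin_parseval_polylogRem.1.comp_neg).const_mul (1 / (Real.pi : ℂ))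
  exact h.congr (ae_of_all _ fun t => (su3Integrand_eq t).symm)

theorem half_integral_su3Integrand :
    1 / 2 * ∫ t : ℝ, su3Integrand t = mellin (fun x => polylogExp 0 x * polylogRem 2 0 x) 0 := by
  rw [mellin_parseval_polylogRem.2]
  simp only [su3Integrand_eq]
  rw [integral_const_mul, integral_neg_eq_self (fun y : ℝ =>
    mellin (polylogExp 0) ((3 / 2 : ℝ) - y * Complex.I) *
      mellin (polylogRem 2 0) (((-(3 / 2) : ℝ) : ℂ) + y * Complex.I)), ← mul_assoc]
  congr 1
  have hpi : (Real.pi : ℂ) ≠ 0 := by exact_mod_cast Real.pi_ne_zero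
  field_simp

/-! ### Evaluation of the Parseval side at $s=0$. -/

theorem riemannZeta_neg_one : riemannZeta (-1) = -1 / 12 := by
  have h := riemannZeta_neg_nat_eq_bernoulli' 1
  rw [Nat.cast_one, bernoulli'_two] at h
  rw [h]
  norm_num

theorem polylogRem_two_zero_eq (x : ℝ) :
    polylogRem 2 0 x = polylogExp 0 x - (x : ℂ) ^ (-1 : ℂ) + 1 / 2 - 1 / 12 * x := by
  simp only [polylogRem, polylogReg, Finset.sum_range_succ, Finset.sum_range_zero, polylogCoeff]
  simp [riemannZeta_zero, riemannZeta_neg_one]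
  ring

theorem isBigO_polylogExp_mul_rem_atTop :
    (fun x => polylogExp 0 x * polylogRem 2 0 x) =O[atTop] fun x => Real.exp (-(1 / 2) * x) := by
  obtain ⟨C, hC, hb⟩ := exists_norm_polylogRem_two_zero_le
  have h1 : polylogRem 2 0 =O[atTop] fun x : ℝ => x ^ (1 : ℝ) :=
    isBigO_rpow_of_forall_pos (eventually_gt_atTop 0) fun x hx => (hb x hx).1
  have h2 := (isBigO_polylogExp_atTop 0).mul
    (h1.trans (isLittleO_rpow_exp_pos_mul_atTop 1 (b := 1 / 2) (by norm_num)).isBigO)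
  refine h2.congr_right fun x => ?_
  rw [← Real.exp_add]
  congr 1
  ring

theorem isBigO_polylogExp_mul_rem_nhdsGT :
    (fun x => polylogExp 0 x * polylogRem 2 0 x) =O[𝓝[>] 0] fun x : ℝ => x ^ (-(-1) : ℝ) := by
  obtain ⟨C, hC, hb⟩ := exists_norm_polylogRem_two_zero_le
  have h1 : polylogRem 2 0 =O[𝓝[>] 0] fun x : ℝ => x ^ (2 : ℝ) :=
    isBigO_rpow_of_forall_pos self_mem_nhdsWithin fun x hx => (hb x hx).2
  have h2 := (isBigO_polylogExp_nhdsGT (w := 0) (by simp)).mul h1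
  refine h2.congr' EventuallyEq.rfl ?_
  filter_upwards [self_mem_nhdsWithin] with x hx
  rw [← Real.rpow_add hx]
  norm_num

theorem differentiableAt_mellin_polylogExp_mul_rem {s : ℂ} (hs : -1 < s.re) :
    DifferentiableAt ℂ (mellin fun x => polylogExp 0 x * polylogRem 2 0 x) s :=
  mellin_differentiableAt_of_isBigO_rpow_exp (by norm_num)
    (((continuousOn_polylogExp 0).mul continuousOn_polylogRem_two_zero).locallyIntegrableOn
      measurableSet_Ioi) isBigO_polylogExp_mul_rem_atTop isBigO_polylogExp_mul_rem_nhdsGT hs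

/-- Expanding the remainder as $\mathrm{Li}_0-x^{-1}+\frac12-\frac{x}{12}$ and linearising
$\mathrm{Li}_0^2$ makes each term a shifted $\Gamma\zeta$. The individual transforms need
$\operatorname{Re}s>2$, although the product converges for $\operatorname{Re}s>-1$. -/
theorem mellin_polylogExp_mul_rem_of_two_lt {s : ℂ} (hs : 2 < s.re) :
    mellin (fun x => polylogExp 0 x * polylogRem 2 0 x) s =
      Complex.Gamma s * (riemannZeta (s - 1) - riemannZeta s - riemannZeta (s - 1) / (s - 1) +
        riemannZeta s / 2 - s * riemannZeta (s + 1) / 12) := by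
  have c0 : ∀ z : ℂ, 1 < z.re → HasMellin (polylogExp 0) z (Complex.Gamma z * riemannZeta z) :=
    fun z hz => ⟨mellinConvergent_polylogExp (by simp) (by simpa using hz),
      by simpa using mellin_polylogExp (w := 0) (by linarith) (by simpa using hz)⟩
  have h1 := hasMellin_sub (mellinConvergent_polylogExp (w := -1) (s := s) (by simp)
    (by simp; linarith)) (c0 s (by linarith)).1
  have h2 : MellinConvergent (fun x : ℝ => (x : ℂ) ^ (-1 : ℂ) • polylogExp 0 x) s :=
    MellinConvergent.cpow_smul.2 (c0 _ (by simp; linarith)).1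
  have h3 : MellinConvergent (fun x : ℝ => (x : ℂ) ^ (1 : ℂ) • polylogExp 0 x) s :=
    MellinConvergent.cpow_smul.2 (c0 _ (by simp; linarith)).1
  have h4 := hasMellin_sub h1.1 h2
  have h5 := hasMellin_add h4.1 ((c0 s (by linarith)).1.const_smul (1 / 2 : ℂ))
  have h6 := hasMellin_sub h5.1 (h3.const_smul (1 / 12 : ℂ))
  have heq : mellin (fun x => polylogExp 0 x * polylogRem 2 0 x) s =
      mellin (fun x : ℝ => polylogExp (-1) x - polylogExp 0 x -
        (x : ℂ) ^ (-1 : ℂ) • polylogExp 0 x + (1 / 2 : ℂ) • polylogExp 0 x -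
        (1 / 12 : ℂ) • (x : ℂ) ^ (1 : ℂ) • polylogExp 0 x) s := by
    refine setIntegral_congr_fun measurableSet_Ioi fun x hx => ?_
    simp only [smul_eq_mul, ← polylogExp_zero_sq hx, polylogRem_two_zero_eq, Complex.cpow_one]
    ring
  have hs1 : s - 1 ≠ 0 := fun h => by
    have := congrArg Complex.re h
    simp at this
    linarith
  have hs0 : s ≠ 0 := by rintro rfl; simp at hs; linarith
  have hΓ : Complex.Gamma s = (s - 1) * Complex.Gamma (s - 1) := by
    rw [← Complex.Gamma_add_one _ hs1, sub_add_cancel]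
  rw [heq, h6.2, h5.2, h4.2, h1.2, mellin_const_smul, mellin_const_smul, mellin_cpow_smul,
    mellin_cpow_smul, (c0 s (by linarith)).2, (c0 (s + 1) (by simp; linarith)).2,
    (c0 (s + -1) (by simp; linarith)).2, mellin_polylogExp (by linarith) (by simp; linarith),
    Complex.Gamma_add_one _ hs0, ← sub_eq_add_neg, hΓ]
  simp only [smul_eq_mul]
  field_simp

theorem mellin_polylogExp_mul_rem_zero :
    mellin (fun x => polylogExp 0 x * polylogRem 2 0 x) 0 =
      2 * deriv riemannZeta (-1) + Real.log (2 * Real.pi) / 4 -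
        (1 + Real.eulerMascheroniConstant) / 12 := by
  set K : ℂ → ℂ := mellin fun x => polylogExp 0 x * polylogRem 2 0 x with hK
  -- `H` is the factor of $\Gamma(s)$ in `R`, with $s\zeta(s+1)$ replaced by its regular form
  -- $1+s\,\zeta_0(s+1)$; $\zeta_0(1)=\gamma$ is the source of Euler's constant. Since $H(0)=0$ and
  -- $\Gamma(s)=\Gamma(s+1)/s$, the value sought is the slope limit $H'(0)$.
  let H : ℂ → ℂ := fun s => riemannZeta (s - 1) - riemannZeta s - riemannZeta (s - 1) / (s - 1) +
    riemannZeta s / 2 - (1 + s * riemannZeta₀ (s + 1)) / 12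
  let R : ℂ → ℂ := fun s => Complex.Gamma s * (riemannZeta (s - 1) - riemannZeta s -
    riemannZeta (s - 1) / (s - 1) + riemannZeta s / 2 - s * riemannZeta (s + 1) / 12)
  have hUo : IsOpen {s : ℂ | -1 < s.re} := isOpen_lt continuous_const Complex.continuous_re
  have hKd : DifferentiableOn ℂ K {s | -1 < s.re} := fun s hs =>
    (differentiableAt_mellin_polylogExp_mul_rem hs).differentiableWithinAt
  have hKm : MeromorphicOn K {s | -1 < s.re} := fun s hs =>
    (hKd.analyticAt (hUo.mem_nhds hs)).meromorphicAt
  have hRm : MeromorphicOn R {s | -1 < s.re} := fun s _ => by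
    have hsub : MeromorphicAt (fun s => riemannZeta (s - 1)) s :=
      MeromorphicAt.comp_analyticAt (f := riemannZeta) (g := fun s => s - 1)
        (meromorphicAt_riemannZeta _) (by fun_prop)
    have hadd : MeromorphicAt (fun s => riemannZeta (s + 1)) s :=
      MeromorphicAt.comp_analyticAt (f := riemannZeta) (g := fun s => s + 1)
        (meromorphicAt_riemannZeta _) (by fun_prop)
    have hz := meromorphicAt_riemannZeta s
    have hid : MeromorphicAt (fun s : ℂ => s) s := MeromorphicAt.id s
    exact (MeromorphicNFOn.Gamma (mem_univ s)).meromorphicAt.mul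
      ((((hsub.sub hz).sub (hsub.div (hid.sub (MeromorphicAt.const 1 s)))).add
        (hz.div (MeromorphicAt.const 2 s))).sub ((hid.mul hadd).div (MeromorphicAt.const 12 s)))
  have hloc : K =ᶠ[𝓝[≠] (3 : ℂ)] R := by
    have h : {s : ℂ | 2 < s.re} ∈ 𝓝 (3 : ℂ) :=
      (isOpen_lt continuous_const Complex.continuous_re).mem_nhds (by simp; norm_num)
    filter_upwards [mem_nhdsWithin_of_mem_nhds h] with s hs
      using mellin_polylogExp_mul_rem_of_two_lt hs
  have h0 : K =ᶠ[𝓝[≠] (0 : ℂ)] R := hKm.eventuallyEq_nhdsNE_of_isPreconnected hRm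
    (convex_halfSpace_re_gt (-1)).isPreconnected (x := 3) (by simp; norm_num) (by simp) hloc
  have hz0 : HasDerivAt riemannZeta (deriv riemannZeta 0) 0 :=
    (differentiableAt_riemannZeta zero_ne_one).hasDerivAt
  have hz1 : HasDerivAt (fun s => riemannZeta (s - 1)) (deriv riemannZeta (-1)) 0 :=
    HasDerivAt.comp_sub_const (f := riemannZeta) 0 1 (by
      rw [zero_sub]
      exact (differentiableAt_riemannZeta (by norm_num)).hasDerivAt)
  have hz2 : HasDerivAt (fun s => riemannZeta₀ (s + 1)) (deriv riemannZeta₀ (0 + 1)) 0 :=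
    HasDerivAt.comp_add_const (f := riemannZeta₀) 0 1 (differentiable_riemannZeta₀ _).hasDerivAt
  have hid := hasDerivAt_id (0 : ℂ)
  have hH : HasDerivAt H (2 * deriv riemannZeta (-1) + Real.log (2 * Real.pi) / 4 -
        (1 + Real.eulerMascheroniConstant) / 12) 0 := by
    have h := (((hz1.sub hz0).sub (hz1.div (hid.sub_const 1) (by simp))).add
      (hz0.div_const 2)).sub (((hid.mul hz2).const_add 1).div_const 12)
    refine h.congr_deriv ?_
    have hlog : Complex.log (2 * Real.pi) = (Real.log (2 * Real.pi) : ℂ) := by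
      rw [Complex.ofReal_log (by positivity)]; push_cast; rfl
    simp only [id_eq, zero_add, zero_sub, riemannZeta₀_one, deriv_riemannZeta_zero, hlog,
      riemannZeta_neg_one]
    ring
  have hH0 : H 0 = 0 := by
    simp only [H, zero_sub, riemannZeta_zero, riemannZeta_neg_one]
    norm_num
  have hslope := hasDerivAt_iff_tendsto_slope.1 hH
  have hG : Tendsto (fun s => Complex.Gamma (s + 1)) (𝓝[≠] 0) (𝓝 1) := by
    have h1 : ContinuousAt Complex.Gamma (0 + 1) := by
      refine (Complex.differentiableAt_Gamma _ fun m hm => ?_).continuousAt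
      have := congrArg Complex.re hm
      simp at this
      linarith [(Nat.cast_nonneg m : (0 : ℝ) ≤ m)]
    have h2 : ContinuousAt (fun s => Complex.Gamma (s + 1)) 0 :=
      ContinuousAt.comp (f := fun s : ℂ => s + 1) h1 (by fun_prop)
    have h3 := h2.tendsto.mono_left (nhdsWithin_le_nhds (s := {0}ᶜ))
    simpa using h3
  have hlim := hG.mul hslope
  rw [one_mul] at hlim
  have hKc : Tendsto K (𝓝[≠] 0) (𝓝 (K 0)) :=
    (hKd.differentiableAt (hUo.mem_nhds (by simp))).continuousAt.tendsto.mono_left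
      nhdsWithin_le_nhds
  refine tendsto_nhds_unique hKc (hlim.congr' ?_)
  filter_upwards [h0, self_mem_nhdsWithin] with s hs hs0
  have hs0 : s ≠ 0 := hs0
  have hζ : riemannZeta (s + 1) = s⁻¹ + riemannZeta₀ (s + 1) := by
    rw [riemannZeta_eq_inv_sub_add (by simpa using hs0), add_sub_cancel_right]
  rw [hs, slope_def_field, hH0, sub_zero, sub_zero]
  simp only [R, H, hζ, Complex.Gamma_add_one _ hs0]
  field_simp

/-! ### Numerical bounds for $\log(2\pi)$. -/

/-- Partial sums of the arctangent series of even length are lower bounds, and those of odd length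
are upper bounds. -/
theorem sum_le_arctan_and_arctan_le_sum {x : ℝ} (hx0 : 0 ≤ x) (hx : x < 1) (n : ℕ) :
    ∑ k ∈ Finset.range (2 * n), (-1) ^ k * (x ^ (2 * k + 1) / (2 * k + 1)) ≤ Real.arctan x ∧
    Real.arctan x ≤ ∑ k ∈ Finset.range (2 * n + 1), (-1) ^ k * (x ^ (2 * k + 1) / (2 * k + 1)) := by
  have ha : Antitone fun k : ℕ => x ^ (2 * k + 1) / (2 * (k : ℝ) + 1) := by
    refine antitone_nat_of_succ_le fun k => ?_
    have h1 : x ^ (2 * (k + 1) + 1) ≤ x ^ (2 * k + 1) :=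
      pow_le_pow_of_le_one hx0 hx.le (by omega)
    push_cast
    gcongr
    linarith
  have hs := Real.hasSum_arctan (x := x) (by rwa [Real.norm_of_nonneg hx0])
  have ht : Tendsto (fun n => ∑ k ∈ Finset.range n, (-1) ^ k * (x ^ (2 * k + 1) / (2 * (k : ℝ) + 1)))
      atTop (𝓝 (Real.arctan x)) := by
    refine hs.tendsto_sum_nat.congr fun n => Finset.sum_congr rfl fun k _ => ?_
    rw [mul_div_assoc]
    push_cast
    rfl
  exact ⟨ha.alternating_series_le_tendsto ht n, ha.tendsto_le_alternating_series ht n⟩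

/-- Machin's formula with 18 terms at $1/5$ and 7 at $1/239$. The extra digits matter: $\log(2\pi)$
exceeds its 20-decimal truncation by less than $7\cdot10^{-22}$, while truncating $\pi$ to 20
decimals already costs a relative error above $8\cdot10^{-22}$. -/
theorem pi_gt_d24 : 3.141592653589793238462643 < Real.pi := by
  have h1 := (sum_le_arctan_and_arctan_le_sum (x := 5⁻¹) (by norm_num) (by norm_num) 9).1
  have h2 := (sum_le_arctan_and_arctan_le_sum (x := 239⁻¹) (by norm_num) (by norm_num) 3).2
  have h3 := Real.four_mul_arctan_inv_5_sub_arctan_inv_239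
  simp only [Finset.sum_range_succ, Finset.sum_range_zero, Nat.reduceMul] at h1 h2
  norm_num at h1 h2 h3 ⊢
  linarith

theorem log_two_mul_pi_gt_d20 : 1.83787706640934548356 < Real.log (2 * Real.pi) := by
  -- Halving the exponent brings it below $1$, where the Taylor bound applies; the value compared
  -- with is then $\sqrt{2\pi}\approx2.5066$, squared at the end.
  have h := Real.exp_bound' (x := 0.91893853320467274178) (by norm_num) (by norm_num) (n := 27)
    (by norm_num)
  rw [Real.lt_log_iff_exp_lt (by positivity),
    show (1.83787706640934548356 : ℝ) = (2 : ℕ) * 0.91893853320467274178 by norm_num,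
    Real.exp_nat_mul]
  have h1 : Real.exp 0.91893853320467274178 < 2.50662827463100050241575 :=
    h.trans_lt (by norm_num [Finset.sum_range_succ, Nat.factorial])
  calc Real.exp 0.91893853320467274178 ^ 2 < 2.50662827463100050241575 ^ 2 := by gcongr
    _ ≤ 2 * 3.141592653589793238462643 := by norm_num
    _ < 2 * Real.pi := by linarith [pi_gt_d24]

theorem log_two_mul_pi_lt_d20 : Real.log (2 * Real.pi) < 1.83787706640934548357 := by
  have h := Real.sum_le_exp_of_nonneg (x := 0.918938533204672741785) (by norm_num) 27
  rw [Real.log_lt_iff_lt_exp (by positivity),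
    show (1.83787706640934548357 : ℝ) = (2 : ℕ) * 0.918938533204672741785 by norm_num,
    Real.exp_nat_mul]
  have h1 : 2.50662827463100050242 ≤ Real.exp 0.918938533204672741785 :=
    le_trans (by norm_num [Finset.sum_range_succ, Nat.factorial]) h
  calc 2 * Real.pi < 2 * 3.14159265358979323847 := by linarith [Real.pi_lt_d20]
    _ ≤ 2.50662827463100050242 ^ 2 := by norm_num
    _ ≤ Real.exp 0.918938533204672741785 ^ 2 := by gcongr

theorem theorem4 :
    (∃! ω : ℂ → ℂ, IsSU3Zeta ω) ∧
    MeasureTheory.Integrable su3Integrand ∧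
    ∀ ω : ℂ → ℂ, IsSU3Zeta ω →
      ∃ d : ℝ, HasDerivAt ω (d : ℂ) 0 ∧
        (d : ℂ) = 1 / 12 * (1 + (Real.eulerMascheroniConstant : ℂ))
          + 3 / 4 * (Real.log (2 * Real.pi) : ℂ)
          - 2 * deriv riemannZeta (-1)
          + 1 / 2 * ∫ t : ℝ, su3Integrand t ∧
        1.83787706640934548356 ≤ d ∧ d < 1.83787706640934548357 := by
  refine ⟨?_, integrable_su3Integrand, fun ω hω => ⟨Real.log (2 * Real.pi), hω.hasDerivAt_zero, ?_,
    log_two_mul_pi_gt_d20.le, log_two_mul_pi_lt_d20⟩⟩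
  · obtain ⟨ω, hω⟩ := exists_isSU3Zeta
    exact ⟨ω, hω, fun ω' hω' => hω'.eq hω⟩
  · rw [half_integral_su3Integrand, mellin_polylogExp_mul_rem_zero]
    ring
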